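/- Fix an infinite set of variables. A literal is a variable $v$ or its complement $\overline{v}$; a clause is a finite set of literals not containing both $v$ and $\overline v$ for any variable $v$; a clause-set is a finite set of clauses, read as a CNF. For a partial assignment $\varphi$ (with finite domain), $\varphi * F$ is obtained from $F$ by removing the clauses containing a true literal and removing the false literals from the remaining ones; $F$ is satisfiable iff $\varphi * F = \emptyset$ for some $\varphi$, and $F \models C$ means that $\varphi * F = \emptyset$ implies $\varphi * \{C\} = \emptyset$ for all $\varphi$. Clauses $C, D$ that clash in exactly one literal $x \in C$, $\overline x \in D$ have the resolvent $(C \cup D) \setminus \{x, \overline x\}$. A resolution tree $R : F \vdash C$ is a full binary tree with clauses of $F$ at its leaves, resolvents of the two children at its inner nodes, and $C$ at its root. The prime implicates of $F$ are the minimal clauses (w.r.t. inclusion) among those $C$ for which some $R : F \vdash C$ exists; clause-sets are equivalent iff they have the same prime implicates. The pure clause of $F$ is the set of literals $x$ occurring in $F$ such that $\overline x$ does not occur in $F$. The Horton-Strahler number $\mathrm{hs}(T)$ of a full binary tree is $0$ for the one-node tree, and if $T$ has the two subtrees $T_1, T_2$ at its root, it is $\max(\mathrm{hs}(T_1),\mathrm{hs}(T_2))$,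 increased by $1$ if $\mathrm{hs}(T_1) = \mathrm{hs}(T_2)$. The hardness $\mathrm{hd}(F)$ is the minimum of $\mathrm{hs}(R)$ over all $R : F \vdash \emptyset$ if $F$ is unsatisfiable, it is $0$ if $F = \emptyset$, and otherwise it is the maximum of $\mathrm{hd}(\varphi * F)$ over all $\varphi$ with $\varphi * F$ unsatisfiable. A minimal premise set is a clause-set $F$ such that for some clause $C$ we have $F \models C$, but $F' \not\models C$ for all $F' \subset F$; a total minimal premise set is a clause-set $F \neq \emptyset$ all of whose non-empty subsets are minimal premise sets. Let $F$ be a saturated minimally unsatisfiable clause-set of deficiency $1$: that is, $F$ is unsatisfiable, $F \setminus \{C\}$ is satisfiable for every $C \in F$, also $(F \setminus \{C\}) \cup \{C \cup \{x\}\}$ is satisfiable for every $C \in F$ and every literal $x$ whose variable does not occur in $C$, and the number of clauses of $F$ is one more than the number of variables occurring in $F$. Then there is exactly one full binary tree $T$ (with ordered children) with inner nodes labelled by pairwise different variables such that $F = \{C_w : w \text{ a leaf of } T\}$; here the edge from an inner node with label $v$ to its left resp. right child is labelled with $v$ resp. $\overline v$, and $C_w$ is the set of edge labels on the path from the root to $w$.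 For a literal $x$ labelling an edge of $T$ let $T_x$ be the subtree below that edge. Choose any pairwise different variables $u_C$ for $C \in F$ that do not occur in $F$, and let $D(F) := \{C \cup \{u_C\} : C \in F\}$ be the doping of $F$. For a non-empty set $V$ of leaves of $T$ let $C_V$ be the pure clause of $\{C_w \cup \{u_{C_w}\} : w \in V\}$. Then: 1. For every clause-set $F'$ equivalent to $D(F)$ there is an injection $i : D(F) \to F'$ with $C \subseteq i(C)$ for all $C \in D(F)$. 2. $D(F)$ is a total minimal premise set. 3. The prime implicates of $D(F)$ are exactly the clauses $C_V$ for the non-empty sets $V$ of leaves of $T$. Moreover, $C_V$ is the disjoint union of $U_V := \{u_{C_w} : w \in V\}$ and of the pure clause $P_V$ of $\{C_w : w \in V\}$, where $P_V$ is the set of all literals $x$ labelling an edge of $T$ such that $V$ contains a leaf of $T_x$ but no leaf of $T_{\overline x}$. 4. $\mathrm{hd}(F) = \mathrm{hd}(D(F)) = \mathrm{hs}(T)$. -/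

import Mathlib

namespace DopedCNF

/-- A literal over the set `V` of variables: `(v, true)` is the positive literal `v`,
and `(v, false)` is its complement. -/
abbrev Lit (V : Type*) := V × Bool

/-- The complement of a literal. -/
def Lit.compl {V : Type*} (x : Lit V) : Lit V := (x.1, !x.2)

/-- A finite set of literals; it is a clause iff it satisfies `IsClause`. -/
abbrev LitSet (V : Type*) := Finset (Lit V)

/-- A clause is a finite complement-free set of literals. -/
def IsClause {V : Type*} (C : LitSet V) : Prop := ∀ x ∈ C, Lit.compl x ∉ C

/-- A finite set of finite sets of literals; it is a clause-set iff it satisfies `IsClauseSet`. -/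
abbrev LitSets (V : Type*) := Finset (LitSet V)

/-- A clause-set is a finite set of clauses. -/
def IsClauseSet {V : Type*} (F : LitSets V) : Prop := ∀ C ∈ F, IsClause C

section

variable {V : Type*} [DecidableEq V]

/-- The set of complements of the elements of a set of literals. -/
def complSet (L : LitSet V) : LitSet V := L.image Lit.compl

/-- The variables of a clause. -/
def varsOf (C : LitSet V) : Finset V := C.image Prod.fst

/-- The variables of a clause-set. -/
def vars (F : LitSets V) : Finset V := F.biUnion varsOf

/-! ### Partial assignments -/

/-- A partial assignment: a map to `{0, 1}` defined on some finite set of variables. -/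
structure PartialAssignment (V : Type*) where
  /-- the value of a variable, `none` outside of the domain -/
  val : V → Option Bool
  /-- the domain is finite -/
  finite_dom : {v | val v ≠ none}.Finite

/-- The value of a literal under a partial assignment. -/
def PartialAssignment.lit {V : Type*} (φ : PartialAssignment V) (x : Lit V) : Option Bool :=
  (φ.val x.1).map fun b => if x.2 then b else !b

/-- The application `φ * F`: remove the clauses that contain a true literal, and remove the false
literals from the remaining clauses. -/
def PartialAssignment.apply (φ : PartialAssignment V) (F : LitSets V) : LitSets V :=
  (F.filter fun C => ∀ x ∈ C, φ.lit x ≠ some true).image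
    fun C => C.filter fun x => φ.lit x ≠ some false

/-- Satisfiability: some partial assignment `φ` has `φ * F = ⊤`, the empty clause-set. -/
def IsSat (F : LitSets V) : Prop := ∃ φ : PartialAssignment V, φ.apply F = ∅

/-- Clausal entailment `F ⊨ C`. -/
def Entails (F : LitSets V) (C : LitSet V) : Prop :=
  ∀ φ : PartialAssignment V, φ.apply F = ∅ → φ.apply {C} = ∅

/-! ### Trees, resolution, prime implicates

Full binary trees are `BinaryTree α`, with the labels at the inner nodes; `nil` is the trivial tree,
whose only node is a leaf. -/

/-- The Horton-Strahler number of a full binary tree. -/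
def hortonStrahler {α : Type*} : BinaryTree α → ℕ
  | .nil => 0
  | .node _ l r =>
    if hortonStrahler l = hortonStrahler r then 1 + max (hortonStrahler l) (hortonStrahler r)
    else max (hortonStrahler l) (hortonStrahler r)

/-- `Derives F T C` (also written `T : F ⊢ C`): `T` is a resolution tree that derives `C`, with the
clauses at the leaves all in `F`. An inner node is labelled with its resolution literal. Two
clauses are resolvable iff they clash in exactly one literal. -/
inductive Derives (F : LitSets V) : BinaryTree (Lit V) → LitSet V → Prop
  | leaf {C : LitSet V} (hC : C ∈ F) : Derives F .nil C
  | resolve {T₁ T₂ : BinaryTree (Lit V)} {C D : LitSet V} {x : Lit V}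
      (h₁ : Derives F T₁ C) (h₂ : Derives F T₂ D) (hx : C ∩ complSet D = {x}) :
      Derives F (.node x T₁ T₂) ((C ∪ D) \ {x, Lit.compl x})

/-- The set of prime implicates of a clause-set: the derivable clauses without a derivable
strict sub-clause. -/
def primeImplicates (F : LitSets V) : Set (LitSet V) :=
  {C | (∃ T, Derives F T C) ∧ ∀ C' ⊂ C, ¬ ∃ T, Derives F T C'}

/-- Equivalence of clause-sets. -/
def Equivalent (F G : LitSets V) : Prop := primeImplicates F = primeImplicates G

/-! ### Hardness -/

/-- The minimal Horton-Strahler number of a resolution refutation of `F`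
(`⊤` if there is no refutation). -/
noncomputable def refutationHardness (F : LitSets V) : ℕ∞ :=
  ⨅ (T : BinaryTree (Lit V)) (_ : Derives F T ∅), (hortonStrahler T : ℕ∞)

open Classical in
/-- The hardness of a clause-set. -/
noncomputable def hardness (F : LitSets V) : ℕ∞ :=
  if ¬ IsSat F then refutationHardness F
  else if F = ∅ then 0
  else ⨆ (φ : PartialAssignment V) (_ : ¬ IsSat (φ.apply F)), refutationHardness (φ.apply F)

/-! ### Minimal premise sets -/

/-- `F` is a minimal premise set for the clause `C`. -/
def IsMpsFor (F : LitSets V) (C : LitSet V) : Prop :=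
  Entails F C ∧ ∀ F' ⊂ F, ¬ Entails F' C

/-- `F` is a minimal premise set. -/
def IsMps (F : LitSets V) : Prop :=
  IsClauseSet F ∧ ∃ C : LitSet V, IsClause C ∧ IsMpsFor F C

/-- The set of all minimal premise sub-clause-sets of `F`. -/
def mps (F : LitSets V) : Set (LitSets V) := {F' | F' ⊆ F ∧ IsMps F'}

/-- `F` is a total mps: it is not empty, and its minimal premise sub-clause-sets are all its
non-empty subsets. -/
def IsTotalMps (F : LitSets V) : Prop :=
  IsClauseSet F ∧ F ≠ ∅ ∧ mps F = {F' | F' ⊆ F} \ {∅}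

/-- The pure clause of `F`: the set of pure literals of `F`. -/
def pureClause (F : LitSets V) : LitSet V :=
  F.biUnion id \ (F.biUnion id ∩ complSet (F.biUnion id))

/-! ### Saturated minimally unsatisfiable clause-sets of deficiency 1 -/

/-- `F` is a minimally unsatisfiable clause-set. -/
def IsMinUnsat (F : LitSets V) : Prop :=
  IsClauseSet F ∧ ¬ IsSat F ∧ ∀ C ∈ F, IsSat (F.erase C)

/-- `F` is a saturated minimally unsatisfiable clause-set. -/
def IsSaturatedMinUnsat (F : LitSets V) : Prop :=
  IsMinUnsat F ∧
    ∀ C ∈ F, ∀ x : Lit V, x.1 ∉ varsOf C → IsSat (insert (insert x C) (F.erase C))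

/-- The deficiency of `F`: the number of clauses minus the number of variables. -/
def deficiency (F : LitSets V) : ℤ := (F.card : ℤ) - ((vars F).card : ℤ)

/-! ### Labelled trees and their clause-sets

A node of a full binary tree is given by its position, the list of the steps from the root to it,
where `true` is a step to the left child and `false` a step to the right child. The edge from an
inner node with label `v` to its left child carries the literal `(v, true)`, the one to its right
child the literal `(v, false)`. -/

/-- The label of the inner node at position `p`; `none` if there is no inner node at `p`. -/
def labelAt {V : Type*} : BinaryTree V → List Bool → Option V
  | .nil, _ => none
  | .node v _ _, [] => some v
  | .node _ l r, b :: p => labelAt (if b then l else r) p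

/-- Different inner nodes have different labels. -/
def InjectiveLabels {V : Type*} (T : BinaryTree V) : Prop :=
  ∀ (p q : List Bool) (v : V), labelAt T p = some v → labelAt T q = some v → p = q

/-- The positions of the leaves. -/
def leaves {V : Type*} : BinaryTree V → Finset (List Bool)
  | .nil => {[]}
  | .node _ l r => (leaves l).image (List.cons true) ∪ (leaves r).image (List.cons false)

/-- The set of literals on the path from the root to position `w`; this is `C_w` for a leaf `w`. -/
def clauseAt : BinaryTree V → List Bool → LitSet V
  | .nil, _ => ∅
  | .node _ _ _, [] => ∅
  | .node v l r, b :: p => insert (v, b) (clauseAt (if b then l else r) p)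

/-- The clause-set represented by a labelled tree, consisting of the `C_w` for the leaves `w`. -/
def treeClauses (T : BinaryTree V) : LitSets V := (leaves T).image (clauseAt T)

/-- The leaves of the subtree `T_x` that is reached, from the inner node labelled with the variable
of `x`, by the edge labelled with `x`. -/
def leavesBelow {V : Type*} (T : BinaryTree V) (x : Lit V) : Set (List Bool) :=
  {w | w ∈ leaves T ∧ ∃ p, labelAt T p = some x.1 ∧ p ++ [x.2] <+: w}

/-! ### Doping -/

/-- `u` assigns to the clauses of `F` different variables that do not occur in `F`. Only the values
of `u` on `F` matter. -/
def IsDopingMap (F : LitSets V) (u : LitSet V → V) : Prop :=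
  Set.InjOn u (F : Set (LitSet V)) ∧ ∀ C ∈ F, u C ∉ vars F

/-- The doped clause `C ∪ {u_C}`. -/
def dopedClause (u : LitSet V → V) (C : LitSet V) : LitSet V := insert (u C, true) C

/-- The doped clause-set. -/
def doping (u : LitSet V → V) (F : LitSets V) : LitSets V := F.image (dopedClause u)

/-- The clause `C_W` for a set `W` of leaves: the pure clause of the set of the doped clauses that
belong to the leaves in `W`. -/
def leafSetClause (T : BinaryTree V) (u : LitSet V → V) (W : Finset (List Bool)) : LitSet V :=
  pureClause (W.image fun w => dopedClause u (clauseAt T w))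

/-- The set `U_W` of the doping variables (as positive literals) of the leaves in `W`. -/
def dopingPart (T : BinaryTree V) (u : LitSet V → V) (W : Finset (List Bool)) : LitSet V :=
  W.image fun w => (u (clauseAt T w), true)

/-- The pure clause `P_W` of the set of the (undoped) clauses of the leaves in `W`. -/
def purePart (T : BinaryTree V) (W : Finset (List Bool)) : LitSet V :=
  pureClause (W.image (clauseAt T))

end

end DopedCNF

open DopedCNF

namespace DopedCNF

/-! ### Total assignments -/

/-! The tree. Tarsi's lemma, proved by a Hall matching and relative to a fixed partial assignment
(`card_sub_card_vars_lt`), says that in a minimally unsatisfiable clause-set strict subsets have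
smaller deficiency. With total deficiency 1, a submodularity count then yields a variable `v`
occurring in exactly one clause with each sign (`IsMinUnsat.exists_singular`). Saturation forces
these two clauses to be `C ∪ {v}` and `C ∪ {v̄}` (`IsSaturatedMinUnsat.exists_twins`). Replacing
them by `C` stays in the class (`IsSaturatedMinUnsat.merge_twins`), so by induction a tree exists
for the smaller clause-set; splitting its leaf `C` by `v` gives the tree of `F`. Uniqueness holds
because the root label is the only variable that occurs in every clause, when there is a root label
at all.

The prime implicates. Paths to different leaves separate at some node, so their clauses clash
(`exists_clash`). Hence falsifying `C_w` and `C_W`, for `w ∈ W`, satisfies the clauses of all other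
leaves (`InjectiveLabels.exists_falsifying_leafSetClause`): no premise of `C_W` can be spared.
Resolving along the tree derives `C_W` (`InjectiveLabels.exists_derives`), while every resolution
tree keeps the pure literals of its premises (`Derives.exists_pureClause_subset`), so each derivable
clause contains some `C_W`. The doping variables record `W`, and the `C_W` are pairwise
incomparable. This gives the prime implicates and the total mps property. For the injection, the
assignment that falsifies one doped clause and is true elsewhere must falsify a clause of `F'`; that
clause contains this doped clause and no other.

The hardness. For the upper bound, the tree itself, cut down by the assignment, is a refutation
(`InjectiveLabels.exists_derives_filter`). For the lower bound, the Horton-Strahler number of the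
tree restricted by falsifying a clause `C` bounds below every derivation of `C`
(`InjectiveLabels.restrictedHS_le_hortonStrahler`); for `C = ∅` this is the number of the full tree.
Setting all doping variables to false turns `D(F)` into `F`, which transfers bounds between the two.
-/

theorem Lit.compl_compl {V : Type*} (x : Lit V) : Lit.compl (Lit.compl x) = x := by
  simp [Lit.compl]

theorem Lit.compl_ne {V : Type*} (x : Lit V) : Lit.compl x ≠ x := by
  intro h
  have := congrArg Prod.snd h
  simp [Lit.compl] at this

/-- The total assignment `f` makes some literal of `C` true. -/
def Satisfies {V : Type*} (f : V → Bool) (C : LitSet V) : Prop := ∃ x ∈ C, f x.1 = x.2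

/-- The total assignment `f` satisfies all elements of `F`. -/
def Models {V : Type*} (f : V → Bool) (F : LitSets V) : Prop := ∀ C ∈ F, Satisfies f C

theorem Satisfies.mono {V : Type*} {f : V → Bool} {C D : LitSet V} (h : Satisfies f C)
    (hCD : C ⊆ D) : Satisfies f D := by
  obtain ⟨x, hx, hf⟩ := h
  exact ⟨x, hCD hx, hf⟩

theorem Models.mono {V : Type*} {f : V → Bool} {F G : LitSets V} (h : Models f F) (hG : G ⊆ F) : Models f G :=
  fun C hC => h C (hG hC)

theorem PartialAssignment.lit_eq_true {V : Type*} {φ : PartialAssignment V} {x : Lit V} :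
    φ.lit x = some true ↔ φ.val x.1 = some x.2 := by
  obtain ⟨v, b⟩ := x
  unfold PartialAssignment.lit
  cases φ.val v <;> cases b <;> simp

theorem PartialAssignment.lit_eq_false {V : Type*} {φ : PartialAssignment V} {x : Lit V} :
    φ.lit x = some false ↔ φ.val x.1 = some (!x.2) := by
  obtain ⟨v, b⟩ := x
  unfold PartialAssignment.lit
  cases φ.val v <;> cases b <;> simp

section

variable {V : Type*} [DecidableEq V]

theorem mem_complSet {L : LitSet V} {x : Lit V} : x ∈ complSet L ↔ Lit.compl x ∈ L := by
  unfold complSet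
  rw [Finset.mem_image]
  constructor
  · rintro ⟨y, hy, rfl⟩
    rwa [Lit.compl_compl]
  · intro h
    exact ⟨_, h, Lit.compl_compl x⟩

theorem mem_pureClause {F : LitSets V} {x : Lit V} :
    x ∈ pureClause F ↔ (∃ C ∈ F, x ∈ C) ∧ ∀ C ∈ F, Lit.compl x ∉ C := by
  unfold pureClause
  simp only [Finset.mem_sdiff, Finset.mem_inter, mem_complSet, Finset.mem_biUnion, id, not_and]
  constructor
  · rintro ⟨h1, h2⟩
    exact ⟨h1, fun C hC hx => h2 h1 ⟨C, hC, hx⟩⟩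
  · rintro ⟨h1, h2⟩
    exact ⟨h1, fun _ ⟨C, hC, hx⟩ => h2 C hC hx⟩

theorem mem_varsOf {C : LitSet V} {v : V} : v ∈ varsOf C ↔ ∃ b, (v, b) ∈ C := by
  unfold varsOf
  simp

theorem mem_varsOf_of_mem {C : LitSet V} {x : Lit V} (hx : x ∈ C) : x.1 ∈ varsOf C :=
  mem_varsOf.2 ⟨x.2, hx⟩

theorem mem_vars {F : LitSets V} {v : V} : v ∈ vars F ↔ ∃ C ∈ F, v ∈ varsOf C := by
  unfold vars
  simp

theorem varsOf_insert (x : Lit V) (C : LitSet V) : varsOf (insert x C) = insert x.1 (varsOf C) := by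
  simp [varsOf]

theorem vars_insert (C : LitSet V) (F : LitSets V) : vars (insert C F) = varsOf C ∪ vars F := by
  simp [vars]

theorem vars_union (F G : LitSets V) : vars (F ∪ G) = vars F ∪ vars G := by
  ext v
  simp [mem_vars, or_and_right, exists_or]

theorem vars_mono {F G : LitSets V} (h : F ⊆ G) : vars F ⊆ vars G :=
  Finset.biUnion_subset_biUnion_of_subset_left _ h

theorem satisfies_congr {f g : V → Bool} {C : LitSet V} (h : ∀ v ∈ varsOf C, f v = g v) :
    Satisfies f C ↔ Satisfies g C := by
  unfold Satisfies
  constructor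
  · rintro ⟨x, hx, hf⟩
    exact ⟨x, hx, by rw [← h _ (mem_varsOf_of_mem hx), hf]⟩
  · rintro ⟨x, hx, hf⟩
    exact ⟨x, hx, by rw [h _ (mem_varsOf_of_mem hx), hf]⟩

theorem satisfies_insert {f : V → Bool} {C : LitSet V} {x : Lit V} :
    Satisfies f (insert x C) ↔ f x.1 = x.2 ∨ Satisfies f C := by
  simp [Satisfies]

theorem models_insert {f : V → Bool} {C : LitSet V} {F : LitSets V} :
    Models f (insert C F) ↔ Satisfies f C ∧ Models f F := by
  simp [Models]

theorem models_union {f : V → Bool} {F G : LitSets V} :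
    Models f (F ∪ G) ↔ Models f F ∧ Models f G := by
  simp [Models, or_imp, forall_and]

theorem Models.of_erase {f : V → Bool} {F : LitSets V} {C : LitSet V} (h : Models f (F.erase C))
    (hC : Satisfies f C) : Models f F := by
  intro D hD
  by_cases hDC : D = C
  · rwa [hDC]
  · exact h D (Finset.mem_erase.2 ⟨hDC, hD⟩)

/-! ### Partial assignments and entailment in terms of total assignments -/

theorem PartialAssignment.apply_eq_empty {φ : PartialAssignment V} {F : LitSets V} :
    φ.apply F = ∅ ↔ ∀ C ∈ F, ∃ x ∈ C, φ.val x.1 = some x.2 := by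
  unfold PartialAssignment.apply
  rw [Finset.image_eq_empty, Finset.filter_eq_empty_iff]
  simp only [ne_eq, PartialAssignment.lit_eq_true]
  push Not
  rfl

/-- The restriction of a total assignment to a finite set of variables. -/
def PartialAssignment.restrict (f : V → Bool) (S : Finset V) : PartialAssignment V where
  val v := if v ∈ S then some (f v) else none
  finite_dom := S.finite_toSet.subset (by intro v; simp)

theorem PartialAssignment.restrict_val {f : V → Bool} {S : Finset V} {v : V} (hv : v ∈ S) :
    (PartialAssignment.restrict f S).val v = some (f v) := by
  simp [PartialAssignment.restrict, hv]

theorem PartialAssignment.restrict_apply_eq_empty {f : V → Bool} {F : LitSets V} {S : Finset V}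
    (hS : vars F ⊆ S) : (PartialAssignment.restrict f S).apply F = ∅ ↔ Models f F := by
  rw [PartialAssignment.apply_eq_empty]
  refine forall₂_congr fun C hC => exists_congr fun x => and_congr_right fun hx => ?_
  rw [PartialAssignment.restrict_val (hS (mem_vars.2 ⟨C, hC, mem_varsOf_of_mem hx⟩))]
  simp

theorem isSat_iff {F : LitSets V} : IsSat F ↔ ∃ f, Models f F := by
  constructor
  · rintro ⟨φ, hφ⟩
    rw [PartialAssignment.apply_eq_empty] at hφ
    refine ⟨fun v => (φ.val v).getD true, fun C hC => ?_⟩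
    obtain ⟨x, hx, hv⟩ := hφ C hC
    exact ⟨x, hx, by simp [hv]⟩
  · rintro ⟨f, hf⟩
    exact ⟨_, (PartialAssignment.restrict_apply_eq_empty subset_rfl).2 hf⟩

/-- A complement-free set of literals can be falsified together with a compatible assignment. -/
theorem exists_falsifying {K : LitSet V} (hK : IsClause K) (g : V → Bool) :
    ∃ f : V → Bool, (∀ x ∈ K, f x.1 = !x.2) ∧ ∀ v ∉ varsOf K, f v = g v := by
  refine ⟨fun v => if (v, true) ∈ K then false else if (v, false) ∈ K then true else g v, ?_, ?_⟩
  · rintro ⟨v, b⟩ hx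
    have h := hK _ hx
    cases b <;> simp_all [Lit.compl]
  · intro v hv
    rw [mem_varsOf] at hv
    push Not at hv
    simp [hv]

theorem entails_of_models {F : LitSets V} {C : LitSet V} (hC : IsClause C)
    (h : ∀ f, Models f F → Satisfies f C) : Entails F C := by
  intro φ hφ
  rw [PartialAssignment.apply_eq_empty] at hφ ⊢
  intro D hD
  rw [Finset.mem_singleton] at hD
  subst hD
  -- Unassigned variables get the values that falsify `C`, so a literal of `C` that becomes true
  -- must already be true under `φ`.
  obtain ⟨g, hg, -⟩ := exists_falsifying hC (fun _ => true)
  have hM : Models (fun v => (φ.val v).getD (g v)) F := by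
    intro E hE
    obtain ⟨x, hx, hv⟩ := hφ E hE
    exact ⟨x, hx, by simp [hv]⟩
  obtain ⟨x, hx, hf⟩ := h _ hM
  refine ⟨x, hx, ?_⟩
  have hgx := hg x hx
  cases hv : φ.val x.1 with
  | none => simp [hv, hgx] at hf
  | some b => simp [hv] at hf; rw [hf]

theorem not_entails_of_models {F : LitSets V} {C : LitSet V} {f : V → Bool} (hF : Models f F)
    (hC : ¬ Satisfies f C) : ¬ Entails F C := by
  intro h
  have h1 := h (PartialAssignment.restrict f (vars F ∪ vars {C}))
    ((PartialAssignment.restrict_apply_eq_empty Finset.subset_union_left).2 hF)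
  rw [PartialAssignment.restrict_apply_eq_empty Finset.subset_union_right] at h1
  exact hC (h1 C (Finset.mem_singleton_self C))

/-! ### Resolution -/

/-- A clash across the two parents can only be the resolution literal, which is deleted. -/
theorem Derives.isClause {F : LitSets V} (hF : IsClauseSet F) {R : BinaryTree (Lit V)}
    {C : LitSet V} (h : Derives F R C) : IsClause C := by
  induction h with
  | leaf hC => exact hF _ hC
  | @resolve T₁ T₂ C D x h₁ h₂ hx ih₁ ih₂ =>
    have key : ∀ y ∈ C, Lit.compl y ∈ D → y = x := by
      intro y hy hy'
      have : y ∈ C ∩ complSet D := Finset.mem_inter.2 ⟨hy, mem_complSet.2 hy'⟩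
      rwa [hx, Finset.mem_singleton] at this
    intro y hy hy'
    simp only [Finset.mem_sdiff, Finset.mem_union, Finset.mem_insert, Finset.mem_singleton,
      not_or] at hy hy'
    obtain ⟨hy1, hy2, hy3⟩ := hy
    obtain ⟨hz1, hz2, hz3⟩ := hy'
    rcases hy1 with hy1 | hy1 <;> rcases hz1 with hz1 | hz1
    · exact ih₁ y hy1 hz1
    · exact hy2 (key y hy1 hz1)
    · exact hz2 (key _ hz1 (by rwa [Lit.compl_compl]))
    · exact ih₂ y hy1 hz1

/-- The resolvent deletes both `x` and its complement from the whole union. Complement-freeness of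
the parents guarantees that the true literal of the parent not satisfied through `x` survives. -/
theorem Derives.sound {F : LitSets V} (hF : IsClauseSet F) {R : BinaryTree (Lit V)}
    {C : LitSet V} (h : Derives F R C) {f : V → Bool} (hf : Models f F) : Satisfies f C := by
  induction h with
  | leaf hC => exact hf _ hC
  | @resolve T₁ T₂ C D x h₁ h₂ hx ih₁ ih₂ =>
    have hx' : x ∈ C ∧ Lit.compl x ∈ D := by
      rw [← mem_complSet, ← Finset.mem_inter, hx]
      exact Finset.mem_singleton_self x
    have hxC := h₁.isClause hF x hx'.1
    have hxD := h₂.isClause hF _ hx'.2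
    rw [Lit.compl_compl] at hxD
    by_cases hfx : f x.1 = x.2
    · obtain ⟨z, hz, hfz⟩ := ih₂
      refine ⟨z, ?_, hfz⟩
      have h1 : z ≠ x := by rintro rfl; exact hxD hz
      have h2 : z ≠ Lit.compl x := by rintro rfl; simp [Lit.compl, hfx] at hfz
      simp [hz, h1, h2]
    · obtain ⟨z, hz, hfz⟩ := ih₁
      refine ⟨z, ?_, hfz⟩
      have h1 : z ≠ x := by rintro rfl; exact hfx hfz
      have h2 : z ≠ Lit.compl x := by rintro rfl; exact hxC hz
      simp [hz, h1, h2]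

/-- A literal that is pure in the clauses used by a resolution tree is never resolved away. -/
theorem Derives.exists_pureClause_subset {F : LitSets V} {R : BinaryTree (Lit V)}
    {C : LitSet V} (h : Derives F R C) :
    ∃ G ⊆ F, G.Nonempty ∧ C ⊆ G.biUnion id ∧ pureClause G ⊆ C := by
  induction h with
  | @leaf C hC =>
    refine ⟨{C}, by simpa using hC, by simp, by simp, ?_⟩
    intro x hx
    rw [mem_pureClause] at hx
    simpa using hx.1
  | @resolve T₁ T₂ C D x h₁ h₂ hx ih₁ ih₂ =>
    obtain ⟨G₁, hG₁, hn₁, hs₁, hp₁⟩ := ih₁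
    obtain ⟨G₂, hG₂, hn₂, hs₂, hp₂⟩ := ih₂
    refine ⟨G₁ ∪ G₂, Finset.union_subset hG₁ hG₂, hn₁.mono Finset.subset_union_left, ?_, ?_⟩
    · rw [Finset.union_biUnion]
      exact Finset.sdiff_subset.trans (Finset.union_subset_union hs₁ hs₂)
    · have hx' : x ∈ C ∧ Lit.compl x ∈ D := by
        rw [← mem_complSet, ← Finset.mem_inter, hx]
        exact Finset.mem_singleton_self x
      -- The resolution literal occurs with both signs in the combined premises, so it is not pure
      -- there.
      obtain ⟨C₁, hC₁, hxC⟩ := Finset.mem_biUnion.1 (hs₁ hx'.1)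
      obtain ⟨D₁, hD₁, hxD⟩ := Finset.mem_biUnion.1 (hs₂ hx'.2)
      intro y hy
      rw [mem_pureClause] at hy
      obtain ⟨⟨E, hE, hyE⟩, hy⟩ := hy
      have h1 : y ≠ x := by
        rintro rfl
        exact hy D₁ (Finset.mem_union_right _ hD₁) hxD
      have h2 : y ≠ Lit.compl x := by
        rintro rfl
        exact hy C₁ (Finset.mem_union_left _ hC₁) (by rwa [Lit.compl_compl])
      have h3 : y ∈ C ∪ D := by
        rcases Finset.mem_union.1 hE with hE | hE
        · exact Finset.mem_union_left _ (hp₁ (mem_pureClause.2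
            ⟨⟨E, hE, hyE⟩, fun C hC => hy C (Finset.mem_union_left _ hC)⟩))
        · exact Finset.mem_union_right _ (hp₂ (mem_pureClause.2
            ⟨⟨E, hE, hyE⟩, fun C hC => hy C (Finset.mem_union_right _ hC)⟩))
      simp only [Finset.mem_sdiff, Finset.mem_insert, Finset.mem_singleton, not_or]
      exact ⟨h3, h1, h2⟩

/-- Every derivable clause contains a prime implicate. -/
theorem Derives.exists_primeImplicate_subset {F : LitSets V} {R : BinaryTree (Lit V)}
    {C : LitSet V} (h : Derives F R C) : ∃ D ∈ primeImplicates F, D ⊆ C := by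
  induction C using Finset.strongInduction generalizing R with
  | H C ih =>
    by_cases hC : ∃ C' ⊂ C, ∃ T, Derives F T C'
    · obtain ⟨C', hC', T, hT⟩ := hC
      obtain ⟨D, hD, hDC⟩ := ih C' hC' hT
      exact ⟨D, hD, hDC.trans hC'.subset⟩
    · push Not at hC
      exact ⟨C, ⟨⟨R, h⟩, fun C' hC' ⟨T, hT⟩ => hC C' hC' T hT⟩, subset_rfl⟩

/-- The resolution step on the variable `v`, in the form in which it occurs in trees. -/
theorem Derives.resolve_insert {F : LitSets V} {R₁ R₂ : BinaryTree (Lit V)} {C D : LitSet V} {v : V}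
    (h₁ : Derives F R₁ (insert (v, true) C)) (h₂ : Derives F R₂ (insert (v, false) D))
    (hC : v ∉ varsOf C) (hD : v ∉ varsOf D) (hCD : IsClause (C ∪ D)) :
    Derives F (.node (v, true) R₁ R₂) (C ∪ D) := by
  rw [mem_varsOf] at hC hD
  push Not at hC hD
  have hx : insert (v, true) C ∩ complSet (insert (v, false) D) = {(v, true)} := by
    ext x
    simp only [Finset.mem_inter, mem_complSet, Finset.mem_insert, Finset.mem_singleton]
    constructor
    · rintro ⟨rfl | h, h' | h'⟩
      · rfl
      · rfl
      · rw [← Lit.compl_compl x, h']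
        rfl
      · exact absurd (Finset.mem_union_right _ h') (hCD x (Finset.mem_union_left _ h))
    · rintro rfl
      simp [Lit.compl]
  have h := Derives.resolve h₁ h₂ hx
  have hE : (insert (v, true) C ∪ insert (v, false) D) \ {(v, true), Lit.compl (v, true)} =
      C ∪ D := by
    ext x
    simp only [Finset.mem_sdiff, Finset.mem_union, Finset.mem_insert, Finset.mem_singleton,
      Lit.compl, Bool.not_true, not_or]
    constructor
    · rintro ⟨h, h1, h2⟩
      simpa [h1, h2] using h
    · intro h
      refine ⟨by tauto, ?_, ?_⟩ <;> rintro rfl <;> rcases h with h | h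
      exacts [hC _ h, hD _ h, hC _ h, hD _ h]
  rwa [hE] at h

end

/-! ### Minimally unsatisfiable clause-sets of deficiency 1 -/

section

variable {V : Type*} [DecidableEq V]

/-- Tarsi's lemma, relative to a fixed assignment `g` of the variables in `Z`: the deficiency of a
minimally unsatisfiable clause-set exceeds that of all strict subsets. -/
theorem card_sub_card_vars_lt {g : V → Bool} {Z : Finset V} {Y : LitSets V}
    (hunsat : ∀ f, (∀ z ∈ Z, f z = g z) → ¬ Models f Y)
    (hmin : ∀ Y' ⊂ Y, ∃ f, (∀ z ∈ Z, f z = g z) ∧ Models f Y') {X : LitSets V} (hX : X ⊂ Y) :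
    (X.card : ℤ) - (vars X \ Z).card < Y.card - (vars Y \ Z).card := by
  by_contra hlt
  push Not at hlt
  -- By the negated claim, a strict subset of maximal relative deficiency is also maximal among all
  -- subsets of `Y`, including `Y` itself.
  obtain ⟨M, hM, hmax⟩ := Finset.exists_max_image Y.ssubsets
    (fun M => (M.card : ℤ) - (vars M \ Z).card) ⟨X, Finset.mem_ssubsets.2 hX⟩
  rw [Finset.mem_ssubsets] at hM
  have hmax' : ∀ S ⊆ Y, (S.card : ℤ) - (vars S \ Z).card ≤ M.card - (vars M \ Z).card := by
    intro S hS
    rcases hS.eq_or_ssubset with rfl | hS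
    · exact hlt.trans (hmax X (Finset.mem_ssubsets.2 hX))
    · exact hmax S (Finset.mem_ssubsets.2 hS)
  let t : {C // C ∈ Y \ M} → Finset V := fun C => (varsOf C.1 \ Z) \ vars M
  -- Hall's condition: adding `s` to `M` cannot raise the deficiency, so `s` brings at least as many
  -- new variables as clauses.
  have hall : ∀ s : Finset {C // C ∈ Y \ M}, s.card ≤ (s.biUnion t).card := by
    intro s
    set S : LitSets V := s.map ⟨Subtype.val, Subtype.val_injective⟩ with hSdef
    have hmemS : ∀ C, C ∈ S ↔ ∃ h : C ∈ Y \ M, (⟨C, h⟩ : {C // C ∈ Y \ M}) ∈ s := by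
      intro C
      rw [hSdef, Finset.mem_map]
      constructor
      · rintro ⟨⟨D, hD⟩, hDs, rfl⟩
        exact ⟨hD, hDs⟩
      · rintro ⟨h, hs⟩
        exact ⟨⟨C, h⟩, hs, rfl⟩
    have hScard : S.card = s.card := by rw [hSdef, Finset.card_map]
    have hSY : S ⊆ Y \ M := fun C hC => ((hmemS C).1 hC).1
    have hdisj : Disjoint M S :=
      Finset.disjoint_of_subset_right hSY Finset.disjoint_sdiff
    have hvars : vars (M ∪ S) \ Z ⊆ (vars M \ Z) ∪ s.biUnion t := by
      intro v hv
      simp only [Finset.mem_sdiff, vars_union, Finset.mem_union, Finset.mem_biUnion, t,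
        mem_vars] at hv ⊢
      obtain ⟨hv, hZ⟩ := hv
      by_cases hvM : ∃ C ∈ M, v ∈ varsOf C
      · exact Or.inl ⟨hvM, hZ⟩
      · obtain ⟨C, hC, hvC⟩ := hv.resolve_left hvM
        obtain ⟨h, hs⟩ := (hmemS C).1 hC
        exact Or.inr ⟨⟨C, h⟩, hs, ⟨hvC, hZ⟩, hvM⟩
    have h1 := hmax' (M ∪ S) (Finset.union_subset hM.subset (hSY.trans Finset.sdiff_subset))
    rw [Finset.card_union_of_disjoint hdisj, hScard] at h1
    have h2 := (Finset.card_le_card hvars).trans (Finset.card_union_le _ _)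
    push_cast at h1
    omega
  obtain ⟨m, hm, hmt⟩ := (Finset.all_card_le_biUnion_card_iff_exists_injective t).1 hall
  obtain ⟨f, hfZ, hfM⟩ := hmin M hM
  have hlit : ∀ C : {C // C ∈ Y \ M}, ∃ b, (m C, b) ∈ C.1 := by
    intro C
    have := hmt C
    simp only [t, Finset.mem_sdiff] at this
    exact mem_varsOf.1 this.1.1
  choose b hb using hlit
  have hext : ∀ v, (v ∈ Z ∨ v ∈ vars M) → Function.extend m b f v = f v := by
    intro v hv
    refine Function.extend_apply' _ _ _ ?_
    rintro ⟨C, rfl⟩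
    have := hmt C
    simp only [t, Finset.mem_sdiff] at this
    tauto
  -- A model of `M` is changed only on the matched variables, which occur neither in `Z` nor in `M`;
  -- each remaining clause is satisfied through its own variable.
  refine hunsat (Function.extend m b f) (fun z hz => (hext z (Or.inl hz)).trans (hfZ z hz)) ?_
  intro C hC
  by_cases hCM : C ∈ M
  · exact (satisfies_congr fun v hv => hext v (Or.inr (mem_vars.2 ⟨C, hCM, hv⟩))).2 (hfM C hCM)
  · let C' : {C // C ∈ Y \ M} := ⟨C, Finset.mem_sdiff.2 ⟨hC, hCM⟩⟩
    exact ⟨(m C', b C'), hb C', hm.extend_apply b f C'⟩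

/-! ### From deficiency 1 to a variable occurring once in each sign -/

theorem IsMinUnsat.not_models {F : LitSets V} (hF : IsMinUnsat F) (f : V → Bool) : ¬ Models f F :=
  fun h => hF.2.1 (isSat_iff.2 ⟨f, h⟩)

theorem IsMinUnsat.exists_models_erase {F : LitSets V} (hF : IsMinUnsat F) {C : LitSet V}
    (hC : C ∈ F) : ∃ f, Models f (F.erase C) ∧ ¬ Satisfies f C := by
  obtain ⟨f, hf⟩ := isSat_iff.1 (hF.2.2 C hC)
  exact ⟨f, hf, fun h => hF.not_models f (hf.of_erase h)⟩

theorem IsMinUnsat.exists_models {F : LitSets V} (hF : IsMinUnsat F) {G : LitSets V}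
    (hG : G ⊂ F) : ∃ f, Models f G := by
  obtain ⟨C, hC, hCG⟩ := Finset.exists_of_ssubset hG
  obtain ⟨f, hf, -⟩ := hF.exists_models_erase hC
  exact ⟨f, hf.mono fun D hD => Finset.mem_erase.2 ⟨by rintro rfl; exact hCG hD, hG.subset hD⟩⟩

/-- Tarsi's lemma with no variable fixed: strict subsets have deficiency below 1, hence at most 0.
-/
theorem IsMinUnsat.card_le_card_vars {F : LitSets V} (hF : IsMinUnsat F)
    (hcard : F.card = (vars F).card + 1) {X : LitSets V} (hX : X ⊂ F) :
    X.card ≤ (vars X).card := by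
  have h := card_sub_card_vars_lt (g := fun _ => true) (Z := ∅) (fun f _ => hF.not_models f)
    (fun Y' hY' => by simpa using hF.exists_models hY') hX
  simp only [Finset.sdiff_empty] at h
  omega

/-- If `v` occurred with only one sign, a model of the rest of `F` could be changed at `v` to
satisfy the removed clause without harming any other. -/
theorem IsMinUnsat.exists_mem {F : LitSets V} (hF : IsMinUnsat F) {v : V} (hv : v ∈ vars F)
    (b : Bool) : ∃ C ∈ F, (v, b) ∈ C := by
  by_contra hno
  push Not at hno
  obtain ⟨C, hC, hvC⟩ := mem_vars.1 hv
  obtain ⟨b', hb'⟩ := mem_varsOf.1 hvC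
  have hbb : b' = !b := by
    rcases Bool.eq_or_eq_not b' b with rfl | h
    · exact absurd hb' (hno C hC)
    · exact h
  obtain ⟨f, hf, -⟩ := hF.exists_models_erase hC
  refine hF.not_models (Function.update f v b') ?_
  intro D hD
  by_cases hDC : D = C
  · exact ⟨(v, b'), by rwa [hDC], by simp⟩
  · obtain ⟨x, hx, hfx⟩ := hf D (Finset.mem_erase.2 ⟨hDC, hD⟩)
    refine ⟨x, hx, ?_⟩
    by_cases hxv : x.1 = v
    · rw [hxv, Function.update_self, hbb]
      rcases Bool.eq_or_eq_not x.2 b with h | h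
      · exact absurd (by rw [← hxv, ← h]; exact hx) (hno D hD)
      · exact h.symm
    · rwa [Function.update_of_ne hxv]

/-- The clauses that are used when the variable `v` is set to `b`. -/
theorem IsMinUnsat.exists_split {F : LitSets V} (hF : IsMinUnsat F) (v : V) (b : Bool) :
    ∃ Y ⊆ F, (∀ f, f v = b → ¬ Models f Y) ∧ (∀ C ∈ Y, (v, b) ∉ C) ∧
      (vars Y).card ≤ Y.card := by
  classical
  -- A smallest subset that is unsatisfiable under `v = b` is minimally so, hence contains no clause
  -- already made true by `v = b`.
  obtain ⟨Y, hY, hmin⟩ := Finset.exists_min_image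
    (F.powerset.filter fun Y => ∀ f : V → Bool, f v = b → ¬ Models f Y) Finset.card
    ⟨F, by simpa using fun f _ => hF.not_models f⟩
  simp only [Finset.mem_filter, Finset.mem_powerset] at hY hmin
  have hmin' : ∀ Y' ⊂ Y, ∃ f : V → Bool, f v = b ∧ Models f Y' := by
    intro Y' hY'
    by_contra hno
    push Not at hno
    exact absurd (hmin Y' ⟨hY'.subset.trans hY.1, hno⟩) (not_le.2 (Finset.card_lt_card hY'))
  refine ⟨Y, hY.1, hY.2, ?_, ?_⟩
  · intro C hC hvC
    obtain ⟨f, hf, hfY⟩ := hmin' _ (Finset.erase_ssubset hC)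
    exact hY.2 f hf (hfY.of_erase ⟨_, hvC, hf⟩)
  · have hne : ∅ ⊂ Y := by
      rw [Finset.empty_ssubset]
      by_contra hY0
      rw [Finset.not_nonempty_iff_eq_empty] at hY0
      exact hY.2 (fun _ => b) rfl (by simp [hY0, Models])
    -- Comparison with the empty subset gives `Y` relative deficiency at least 1; counting `v` again
    -- costs at most one variable.
    have h := card_sub_card_vars_lt (g := fun _ => b) (Z := {v})
      (by simpa using hY.2) (by simpa using hmin') hne
    have h2 : (vars Y).card ≤ (vars Y \ {v}).card + 1 := by
      have := Finset.card_le_card_sdiff_add_card (s := vars Y) (t := {v})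
      simpa using this
    have h3 : ((vars (∅ : LitSets V) \ {v}).card : ℤ) = 0 := by simp [vars]
    rw [h3, Finset.card_empty] at h
    push_cast at h
    omega

/-- A minimally unsatisfiable clause-set of deficiency `1` with at least two clauses has a variable
that occurs exactly once positively and exactly once negatively. -/
theorem IsMinUnsat.exists_singular {F : LitSets V} (hF : IsMinUnsat F)
    (hcard : F.card = (vars F).card + 1) (h2 : 2 ≤ F.card) :
    ∃ v, ∀ b, ∃ C ∈ F, (v, b) ∈ C ∧ ∀ D ∈ F, (v, b) ∈ D → D = C := by
  -- `B` is a largest subset of non-negative deficiency that omits at least two clauses. The bound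
  -- `|B| + 2 ≤ |F|` makes `B` miss some variable `v`, which turns out to be the required one.
  obtain ⟨B, hB, hmax⟩ := Finset.exists_max_image
    (F.powerset.filter fun B => B.card + 2 ≤ F.card ∧ (vars B).card ≤ B.card) Finset.card
    ⟨∅, Finset.mem_filter.2 ⟨by simp, by simpa using h2, by simp [vars]⟩⟩
  simp only [Finset.mem_filter, Finset.mem_powerset] at hB hmax
  obtain ⟨hBF, hB2, hBt⟩ := hB
  obtain ⟨v, hvF, hvB⟩ : ∃ v ∈ vars F, v ∉ vars B :=
    Finset.exists_mem_notMem_of_card_lt_card (by omega)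
  have hvB' : ∀ C ∈ B, ∀ b, (v, b) ∉ C := fun C hC b hb =>
    hvB (mem_vars.2 ⟨C, hC, mem_varsOf.2 ⟨b, hb⟩⟩)
  choose Y hYF hYun hYnot hYt using hF.exists_split v
  have hcover : Y true ∪ Y false = F := by
    by_contra hne
    obtain ⟨f, hf⟩ := hF.exists_models
      ((Finset.union_subset (hYF true) (hYF false)).ssubset_of_ne hne)
    rw [models_union] at hf
    cases hfv : f v
    · exact hYun _ f hfv hf.2
    · exact hYun _ f hfv hf.1
  -- `Y (!b)` contains no clause with the literal `(v, !b)`, so by the covering these clauses lie in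
  -- `Y b`.
  have hmem : ∀ b, ∀ C ∈ F, (v, !b) ∈ C → C ∈ Y b := by
    intro b C hC hvC
    rw [← hcover, Finset.mem_union] at hC
    rcases hC with hC | hC <;> cases b
    · exact absurd hvC (hYnot _ _ hC)
    · exact hC
    · exact hC
    · exact absurd hvC (hYnot _ _ hC)
  refine ⟨v, fun b => ?_⟩
  obtain ⟨C, hC, hvC⟩ := hF.exists_mem hvF b
  refine ⟨C, hC, hvC, fun D hD hvD => ?_⟩
  by_contra hDC
  obtain ⟨E, hE, hvE⟩ := hF.exists_mem hvF (!b)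
  have hnot : ∀ C, (v, b) ∈ C → C ∉ Y b ∪ B := by
    intro C hvC hC
    rcases Finset.mem_union.1 hC with h | h
    · exact hYnot b C h hvC
    · exact hvB' C h b hvC
  have hU : Y b ∪ B ⊆ F := Finset.union_subset (hYF b) hBF
  -- Two different clauses with the literal `(v, b)` would both lie outside `Y b ∪ B`.
  have hUcard : (Y b ∪ B).card + 2 ≤ F.card := by
    have hCD : ({C, D} : LitSets V).card = 2 := Finset.card_pair (Ne.symm hDC)
    have hdis : Disjoint (Y b ∪ B) {C, D} := by
      rw [Finset.disjoint_right]
      intro X hX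
      simp only [Finset.mem_insert, Finset.mem_singleton] at hX
      rcases hX with rfl | rfl
      · exact hnot _ hvC
      · exact hnot _ hvD
    rw [← hCD, ← Finset.card_union_of_disjoint hdis]
    refine Finset.card_le_card (Finset.union_subset hU ?_)
    intro X hX
    simp only [Finset.mem_insert, Finset.mem_singleton] at hX
    rcases hX with rfl | rfl <;> assumption
  -- Submodularity: `Y b` and `B` have deficiency at least 0, their intersection at most 0, so their
  -- union has deficiency at least 0.
  have hUt : (vars (Y b ∪ B)).card ≤ (Y b ∪ B).card := by
    have h1 : Y b ∩ B ⊂ F := by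
      refine (Finset.inter_subset_right.trans hBF).ssubset_of_ne ?_
      intro h
      have := Finset.card_le_card (Finset.inter_subset_right (s₁ := Y b) (s₂ := B))
      rw [h] at this
      omega
    have h2 := hF.card_le_card_vars hcard h1
    have h3 : (vars (Y b ∩ B)).card ≤ (vars (Y b) ∩ vars B).card :=
      Finset.card_le_card (Finset.subset_inter (vars_mono Finset.inter_subset_left)
        (vars_mono Finset.inter_subset_right))
    have h4 := Finset.card_union_add_card_inter (vars (Y b)) (vars B)
    have h5 := Finset.card_union_add_card_inter (Y b) B
    have h6 := hYt b
    rw [vars_union]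
    omega
  have h1 := hmax _ ⟨hU, hUcard, hUt⟩
  -- By maximality `Y b ⊆ B`, but `Y b` contains `E`, in which `v` occurs.
  have h2 : B = Y b ∪ B := Finset.eq_of_subset_of_card_le Finset.subset_union_right h1
  have h3 : E ∈ B := by
    rw [h2]
    exact Finset.mem_union_left _ (hmem b E hE hvE)
  exact hvB' E h3 _ hvE

/-- In the saturated case the two occurrences of the variable are in clauses that differ only in
that variable. -/
theorem IsSaturatedMinUnsat.exists_twins {F : LitSets V} (hF : IsSaturatedMinUnsat F)
    (hcard : F.card = (vars F).card + 1) (h2 : 2 ≤ F.card) :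
    ∃ (v : V) (C : LitSet V), v ∉ varsOf C ∧ insert (v, true) C ∈ F ∧ insert (v, false) C ∈ F ∧
      ∀ D ∈ F, v ∈ varsOf D → D = insert (v, true) C ∨ D = insert (v, false) C := by
  obtain ⟨v, hv⟩ := hF.1.exists_singular hcard h2
  choose C hCF hvC hCu using hv
  -- Flipping `v` to `b` satisfies `C b` and endangers only `C (!b)`, so no other literal of `C
  -- (!b)` may be true.
  have hclash : ∀ b, ∀ f : V → Bool, Models f (F.erase (C b)) → f v = (!b) →
      (∃ x ∈ C (!b), x.1 ≠ v ∧ f x.1 = x.2) → False := by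
    rintro b f hf hfv ⟨x, hx, hxv, hfx⟩
    refine hF.1.not_models (Function.update f v b) fun D hD => ?_
    by_cases h1 : (v, b) ∈ D
    · exact ⟨_, h1, by simp⟩
    by_cases h2 : (v, !b) ∈ D
    · rw [hCu _ D hD h2]
      exact ⟨x, hx, by rwa [Function.update_of_ne hxv]⟩
    · have hDC : D ≠ C b := by rintro rfl; exact h1 (hvC b)
      obtain ⟨y, hy, hfy⟩ := hf D (Finset.mem_erase.2 ⟨hDC, hD⟩)
      refine ⟨y, hy, ?_⟩
      rw [Function.update_of_ne]
      · exact hfy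
      · rintro hyv
        rcases Bool.eq_or_eq_not y.2 b with h | h
        · exact h1 (by rw [← hyv, ← h]; exact hy)
        · exact h2 (by rw [← hyv, ← h]; exact hy)
  have hfalse : ∀ b, ∀ f : V → Bool, ¬ Satisfies f (C b) → f v = (!b) := by
    intro b f hf
    rcases Bool.eq_or_eq_not (f v) b with h | h
    · exact absurd ⟨_, hvC b, h⟩ hf
    · exact h
  -- A literal `x` missing from `C b` can be made true while `C b` stays false: either its
  -- complement is in `C b`, or saturation provides the model after adding `x` to `C b`. Both
  -- contradict `hclash`.
  have hsub : ∀ b, ∀ x ∈ C (!b), x.1 ≠ v → x ∈ C b := by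
    intro b x hx hxv
    by_contra hxC
    by_cases hxc : Lit.compl x ∈ C b
    · obtain ⟨f, hf, hfC⟩ := hF.1.exists_models_erase (hCF b)
      refine hclash b f hf (hfalse b f hfC) ⟨x, hx, hxv, ?_⟩
      by_contra hfx
      exact hfC ⟨_, hxc, by simpa [Lit.compl, ← Bool.eq_not] using hfx⟩
    · have hxvar : x.1 ∉ varsOf (C b) := by
        rw [mem_varsOf]
        rintro ⟨b', hb'⟩
        rcases Bool.eq_or_eq_not b' x.2 with rfl | rfl
        · exact hxC hb'
        · exact hxc hb'
      obtain ⟨f, hf⟩ := isSat_iff.1 (hF.2 (C b) (hCF b) x hxvar)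
      rw [models_insert] at hf
      have hfC : ¬ Satisfies f (C b) := fun h => hF.1.not_models f (hf.2.of_erase h)
      rw [satisfies_insert] at hf
      exact hclash b f hf.2 (hfalse b f hfC) ⟨x, hx, hxv, hf.1.resolve_right hfC⟩
  have hv' : ∀ b, ∀ x ∈ C b, x.1 = v → x = (v, b) := by
    intro b x hx hxv
    rcases Bool.eq_or_eq_not x.2 b with h | h
    · rw [← hxv, ← h]
    · refine absurd (hvC b) ?_
      have := hF.1.1 _ (hCF b) x hx
      rwa [Lit.compl, h, hxv, Bool.not_not] at this
  have hCb : ∀ b, C b = insert (v, b) ((C true).erase (v, true)) := by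
    intro b
    ext x
    by_cases hxv : x.1 = v
    · simp only [Finset.mem_insert, Finset.mem_erase]
      constructor
      · intro h
        exact Or.inl (hv' b x h hxv)
      · rintro (rfl | h)
        · exact hvC b
        · exact absurd (hv' true x h.2 hxv) h.1
    · have h1 : ∀ b', x ≠ (v, b') := by rintro b' rfl; exact hxv rfl
      simp only [Finset.mem_insert, Finset.mem_erase, h1, ne_eq, not_false_eq_true, true_and,
        false_or]
      cases b
      · exact ⟨fun h => hsub true x h hxv, fun h => hsub false x h hxv⟩
      · rfl
  refine ⟨v, (C true).erase (v, true), ?_, ?_, ?_, ?_⟩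
  · rw [mem_varsOf]
    rintro ⟨b, hb⟩
    rw [Finset.mem_erase] at hb
    exact hb.1 (hv' true _ hb.2 rfl)
  · rw [← hCb]; exact hCF _
  · rw [← hCb]; exact hCF _
  · intro D hD hvD
    obtain ⟨b, hb⟩ := mem_varsOf.1 hvD
    rw [← hCb, ← hCb]
    have := hCu b D hD hb
    cases b
    · exact Or.inr this
    · exact Or.inl this

/-- Replacing two twins by their resolvent preserves saturated minimal unsatisfiability. -/
theorem IsSaturatedMinUnsat.merge_twins {F : LitSets V} (hF : IsSaturatedMinUnsat F) {v : V}
    {C : LitSet V} (hvC : v ∉ varsOf C) (h₁ : insert (v, true) C ∈ F)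
    (h₂ : insert (v, false) C ∈ F)
    (honly : ∀ D ∈ F, v ∈ varsOf D → D = insert (v, true) C ∨ D = insert (v, false) C) :
    ∃ G : LitSets V, IsSaturatedMinUnsat (insert C G) ∧ C ∉ G ∧ v ∉ vars (insert C G) ∧
      F = insert (insert (v, true) C) (insert (insert (v, false) C) G) ∧
      F.card = G.card + 2 ∧ vars F = insert v (vars (insert C G)) := by
  have hne : insert (v, true) C ≠ insert (v, false) C := by
    intro h
    have h1 : (v, true) ∈ insert (v, false) C := by rw [← h]; simp
    simp only [Finset.mem_insert, Prod.mk.injEq, Bool.true_eq_false, and_false, false_or] at h1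
    exact hvC (mem_varsOf.2 ⟨_, h1⟩)
  set G := (F.erase (insert (v, true) C)).erase (insert (v, false) C) with hG
  have hFG : F = insert (insert (v, true) C) (insert (insert (v, false) C) G) := by
    rw [hG, Finset.insert_erase (Finset.mem_erase.2 ⟨hne.symm, h₂⟩), Finset.insert_erase h₁]
  have h1G : insert (v, true) C ∉ G := by simp [hG]
  have h2G : insert (v, false) C ∉ G := by simp [hG]
  have h1G' : insert (v, true) C ∉ insert (insert (v, false) C) G := by simp [h1G, hne]
  have hGF : G ⊆ F := (Finset.erase_subset _ _).trans (Finset.erase_subset _ _)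
  have hvG : v ∉ vars G := by
    rw [mem_vars]
    rintro ⟨D, hD, hvD⟩
    rcases honly D (hGF hD) hvD with rfl | rfl
    · exact h1G hD
    · exact h2G hD
  have hboth : ∀ f : V → Bool, Satisfies f (insert (v, true) C) →
      Satisfies f (insert (v, false) C) → Satisfies f C := by
    intro f ha hb
    rw [satisfies_insert] at ha hb
    rcases ha with ha | ha
    · rcases hb with hb | hb
      · exact absurd (ha.symm.trans hb) (by simp)
      · exact hb
    · exact ha
  have hCG : C ∉ G := by
    intro h
    obtain ⟨f, hf, hfC⟩ := hF.1.exists_models_erase h₁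
    refine hfC (Satisfies.mono (hf C (Finset.mem_erase.2 ⟨?_, hGF h⟩)) (Finset.subset_insert _ _))
    rintro heq
    exact hvC (mem_varsOf.2 ⟨true, by rw [heq]; simp⟩)
  have hunsat : ∀ f, ¬ Models f (insert C G) := by
    intro f hf
    rw [models_insert] at hf
    refine hF.1.not_models f ?_
    rw [hFG, models_insert, models_insert]
    exact ⟨hf.1.mono (Finset.subset_insert _ _), hf.1.mono (Finset.subset_insert _ _), hf.2⟩
  have hEne : ∀ E ∈ G, E ≠ C ∧ E ≠ insert (v, true) C ∧ E ≠ insert (v, false) C :=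
    fun E hE => ⟨by rintro rfl; exact hCG hE, by rintro rfl; exact h1G hE,
      by rintro rfl; exact h2G hE⟩
  refine ⟨G, ⟨⟨?_, fun h => ?_, ?_⟩, ?_⟩, hCG, ?_, hFG, ?_, ?_⟩
  · intro D hD
    rcases Finset.mem_insert.1 hD with rfl | hD
    · intro x hx hx'
      exact hF.1.1 _ h₁ x (Finset.mem_insert_of_mem hx) (Finset.mem_insert_of_mem hx')
    · exact hF.1.1 D (hGF hD)
  · obtain ⟨f, hf⟩ := isSat_iff.1 h
    exact hunsat f hf
  · intro E hE
    rw [isSat_iff]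
    rcases Finset.mem_insert.1 hE with rfl | hE
    · rw [Finset.erase_insert hCG]
      obtain ⟨f, hf, -⟩ := hF.1.exists_models_erase h₁
      exact ⟨f, hf.mono fun D hD => Finset.mem_erase.2 ⟨(hEne D hD).2.1, hGF hD⟩⟩
    · obtain ⟨f, hf, -⟩ := hF.1.exists_models_erase (hGF hE)
      refine ⟨f, ?_⟩
      obtain ⟨e1, e2, e3⟩ := hEne E hE
      intro D hD
      rw [Finset.mem_erase, Finset.mem_insert] at hD
      rcases hD with ⟨hDE, rfl | hD⟩
      · exact hboth f (hf _ (Finset.mem_erase.2 ⟨e2.symm, h₁⟩))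
          (hf _ (Finset.mem_erase.2 ⟨e3.symm, h₂⟩))
      · exact hf D (Finset.mem_erase.2 ⟨hDE, hGF hD⟩)
  · intro E hE x hx
    rw [isSat_iff]
    rcases Finset.mem_insert.1 hE with rfl | hE
    · rw [Finset.erase_insert hCG]
      -- If `x` is on `v`, then adding `x` to the merged clause gives one of the twins, and a model
      -- of `F` without the other twin suffices. Otherwise `x` is added to the positive twin, and
      -- the negative twin rules out satisfaction through `v`.
      by_cases hxv : x.1 = v
      · obtain ⟨f, hf, -⟩ := hF.1.exists_models_erase (C := insert (v, !x.2) E)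
          (by cases x.2 <;> assumption)
        refine ⟨f, models_insert.2 ⟨?_, hf.mono fun D hD => Finset.mem_erase.2 ⟨?_, hGF hD⟩⟩⟩
        · refine hf _ (Finset.mem_erase.2 ⟨?_, ?_⟩)
          · obtain ⟨w, b⟩ := x
            simp only at hxv
            subst hxv
            cases b
            · exact hne.symm
            · exact hne
          · obtain ⟨w, b⟩ := x
            simp only at hxv
            subst hxv
            cases b <;> assumption
        · cases x.2
          · exact (hEne D hD).2.1
          · exact (hEne D hD).2.2
      · obtain ⟨f, hf⟩ := isSat_iff.1 (hF.2 (insert (v, true) E) h₁ x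
          (by rw [varsOf_insert, Finset.mem_insert]; tauto))
        rw [models_insert] at hf
        refine ⟨f, models_insert.2 ⟨?_, hf.2.mono fun D hD =>
          Finset.mem_erase.2 ⟨(hEne D hD).2.1, hGF hD⟩⟩⟩
        have hf2 := hf.2 _ (Finset.mem_erase.2 ⟨hne.symm, h₂⟩)
        have hf1 := hf.1
        rw [satisfies_insert] at hf1 hf2 ⊢
        rw [satisfies_insert] at hf1
        rcases hf1 with h | h | h
        · exact Or.inl h
        · rcases hf2 with h' | h'
          · exact absurd (h.symm.trans h') (by simp)
          · exact Or.inr h'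
        · exact Or.inr h
    · obtain ⟨f, hf⟩ := isSat_iff.1 (hF.2 E (hGF hE) x hx)
      rw [models_insert] at hf
      refine ⟨f, models_insert.2 ⟨hf.1, ?_⟩⟩
      obtain ⟨e1, e2, e3⟩ := hEne E hE
      intro D hD
      rw [Finset.mem_erase, Finset.mem_insert] at hD
      rcases hD with ⟨hDE, rfl | hD⟩
      · exact hboth f (hf.2 _ (Finset.mem_erase.2 ⟨e2.symm, h₁⟩))
          (hf.2 _ (Finset.mem_erase.2 ⟨e3.symm, h₂⟩))
      · exact hf.2 D (Finset.mem_erase.2 ⟨hDE, hGF hD⟩)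
  · rw [vars_insert, Finset.mem_union]
    tauto
  · rw [hFG, Finset.card_insert_of_notMem h1G', Finset.card_insert_of_notMem h2G]
  · rw [hFG]
    ext w
    simp only [vars_insert, varsOf_insert, Finset.mem_union, Finset.mem_insert]
    tauto

end

/-! ### Labelled trees -/

section

/-- The left (`true`) or right (`false`) child. -/
def child {V : Type*} (l r : BinaryTree V) : Bool → BinaryTree V
  | true => l
  | false => r

@[simp]
theorem child_true {V : Type*} (l r : BinaryTree V) : child l r true = l := rfl

@[simp]
theorem child_false {V : Type*} (l r : BinaryTree V) : child l r false = r := rfl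

theorem labelAt_cons {V : Type*} {v : V} {l r : BinaryTree V} {b : Bool} {p : List Bool} :
    labelAt (.node v l r) (b :: p) = labelAt (child l r b) p := by
  cases b <;> rfl

theorem mem_leaves_node {V : Type*} {v : V} {l r : BinaryTree V} {w : List Bool} :
    w ∈ leaves (.node v l r) ↔ ∃ b p, w = b :: p ∧ p ∈ leaves (child l r b) := by
  simp only [leaves, Finset.mem_union, Finset.mem_image, Bool.exists_bool]
  constructor
  · rintro (⟨p, hp, rfl⟩ | ⟨p, hp, rfl⟩)
    · exact Or.inr ⟨p, rfl, by simpa using hp⟩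
    · exact Or.inl ⟨p, rfl, by simpa using hp⟩
  · rintro (⟨p, rfl, hp⟩ | ⟨p, rfl, hp⟩)
    · exact Or.inr ⟨p, by simpa using hp, rfl⟩
    · exact Or.inl ⟨p, by simpa using hp, rfl⟩

theorem cons_mem_leaves_node {V : Type*} {v : V} {l r : BinaryTree V} {b : Bool} {p : List Bool} :
    b :: p ∈ leaves (.node v l r) ↔ p ∈ leaves (child l r b) := by
  rw [mem_leaves_node]
  constructor
  · rintro ⟨b', p', h, hp⟩
    obtain ⟨rfl, rfl⟩ := List.cons.inj h
    exact hp
  · exact fun h => ⟨b, p, rfl, h⟩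

theorem leaves_nonempty {V : Type*} (T : BinaryTree V) : (leaves T).Nonempty := by
  induction T with
  | nil => simp [leaves]
  | node v l r ihl ihr =>
    obtain ⟨p, hp⟩ := ihl
    exact ⟨true :: p, cons_mem_leaves_node.2 hp⟩

theorem injectiveLabels_nil {V : Type*} : InjectiveLabels (.nil : BinaryTree V) := by
  intro p q v h
  simp [labelAt] at h

variable {V : Type*} [DecidableEq V]

/-- The set of the labels of the inner nodes. -/
def nodeLabels : BinaryTree V → Finset V
  | .nil => ∅
  | .node v l r => insert v (nodeLabels l ∪ nodeLabels r)

theorem mem_nodeLabels {T : BinaryTree V} {v : V} :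
    v ∈ nodeLabels T ↔ ∃ p, labelAt T p = some v := by
  induction T with
  | nil => simp [nodeLabels, labelAt]
  | node a l r ihl ihr =>
    simp only [nodeLabels, Finset.mem_insert, Finset.mem_union, ihl, ihr]
    constructor
    · rintro (rfl | ⟨p, hp⟩ | ⟨p, hp⟩)
      · exact ⟨[], rfl⟩
      · exact ⟨true :: p, by simpa [labelAt] using hp⟩
      · exact ⟨false :: p, by simpa [labelAt] using hp⟩
    · rintro ⟨_ | ⟨b, p⟩, hp⟩
      · simp only [labelAt, Option.some.injEq] at hp
        exact Or.inl hp.symm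
      · cases b
        · exact Or.inr (Or.inr ⟨p, by simpa [labelAt] using hp⟩)
        · exact Or.inr (Or.inl ⟨p, by simpa [labelAt] using hp⟩)

theorem nodeLabels_child_subset {v : V} {l r : BinaryTree V} (b : Bool) :
    nodeLabels (child l r b) ⊆ nodeLabels (.node v l r) := by
  intro x hx
  cases b
  · exact Finset.mem_insert_of_mem (Finset.mem_union_right _ hx)
  · exact Finset.mem_insert_of_mem (Finset.mem_union_left _ hx)

theorem injectiveLabels_node {v : V} {l r : BinaryTree V} :
    InjectiveLabels (.node v l r) ↔ v ∉ nodeLabels l ∧ v ∉ nodeLabels r ∧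
      Disjoint (nodeLabels l) (nodeLabels r) ∧ InjectiveLabels l ∧ InjectiveLabels r := by
  constructor
  · intro h
    refine ⟨?_, ?_, ?_, ?_, ?_⟩
    · rw [mem_nodeLabels]
      rintro ⟨p, hp⟩
      have := h [] (true :: p) v rfl (by simpa [labelAt] using hp)
      simp at this
    · rw [mem_nodeLabels]
      rintro ⟨p, hp⟩
      have := h [] (false :: p) v rfl (by simpa [labelAt] using hp)
      simp at this
    · rw [Finset.disjoint_left]
      intro w hl hr
      rw [mem_nodeLabels] at hl hr
      obtain ⟨p, hp⟩ := hl
      obtain ⟨q, hq⟩ := hr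
      have := h (true :: p) (false :: q) w (by simpa [labelAt] using hp)
        (by simpa [labelAt] using hq)
      simp at this
    · intro p q w hp hq
      have := h (true :: p) (true :: q) w (by simpa [labelAt] using hp)
        (by simpa [labelAt] using hq)
      simpa using this
    · intro p q w hp hq
      have := h (false :: p) (false :: q) w (by simpa [labelAt] using hp)
        (by simpa [labelAt] using hq)
      simpa using this
  · rintro ⟨hl, hr, hd, il, ir⟩ p q w hp hq
    rw [Finset.disjoint_left] at hd
    simp only [mem_nodeLabels] at hl hr hd
    push Not at hl hr hd
    rcases p with _ | ⟨_ | _, p⟩ <;> rcases q with _ | ⟨_ | _, q⟩ <;>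
      simp only [labelAt, if_true, Bool.false_eq_true, if_false, Option.some.injEq] at hp hq
    · rfl
    · exact absurd (hp ▸ hq) (hr q)
    · exact absurd (hp ▸ hq) (hl q)
    · exact absurd (hq ▸ hp) (hr p)
    · rw [ir p q w hp hq]
    · exact absurd hp (hd ⟨q, hq⟩ p)
    · exact absurd (hq ▸ hp) (hl p)
    · exact absurd hq (hd ⟨p, hp⟩ q)
    · rw [il p q w hp hq]

theorem InjectiveLabels.child {v : V} {l r : BinaryTree V} (h : InjectiveLabels (.node v l r))
    (b : Bool) : InjectiveLabels (child l r b) := by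
  rw [injectiveLabels_node] at h
  cases b <;> simp [h]

theorem InjectiveLabels.notMem_child {v : V} {l r : BinaryTree V}
    (h : InjectiveLabels (.node v l r)) (b : Bool) : v ∉ nodeLabels (DopedCNF.child l r b) := by
  rw [injectiveLabels_node] at h
  cases b <;> simp [h]

theorem InjectiveLabels.notMem_other {v : V} {l r : BinaryTree V}
    (h : InjectiveLabels (.node v l r)) {b : Bool} {x : V}
    (hx : x ∈ nodeLabels (DopedCNF.child l r b)) : x ∉ nodeLabels (DopedCNF.child l r (!b)) := by
  rw [injectiveLabels_node, Finset.disjoint_left] at h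
  cases b
  · exact fun h' => h.2.2.1 (by simpa using h') (by simpa using hx)
  · exact fun h' => h.2.2.1 (by simpa using hx) (by simpa using h')

/-! ### The clauses of a labelled tree -/

theorem clauseAt_cons {v : V} {l r : BinaryTree V} {b : Bool} {p : List Bool} :
    clauseAt (.node v l r) (b :: p) = insert (v, b) (clauseAt (child l r b) p) := by
  cases b <;> rfl

theorem varsOf_clauseAt_subset (T : BinaryTree V) (w : List Bool) :
    varsOf (clauseAt T w) ⊆ nodeLabels T := by
  induction T generalizing w with
  | nil => simp [clauseAt, varsOf]
  | node v l r ihl ihr =>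
    rcases w with _ | ⟨b, p⟩
    · simp [clauseAt, varsOf]
    · rw [clauseAt_cons, varsOf_insert]
      refine Finset.insert_subset (by simp [nodeLabels]) ?_
      refine Finset.Subset.trans ?_ (nodeLabels_child_subset b)
      cases b
      · exact ihr p
      · exact ihl p

theorem fst_mem_nodeLabels {T : BinaryTree V} {w : List Bool} {x : Lit V}
    (hx : x ∈ clauseAt T w) : x.1 ∈ nodeLabels T :=
  varsOf_clauseAt_subset T w (mem_varsOf_of_mem hx)

theorem isClause_insert {C : LitSet V} (hC : IsClause C) {x : Lit V} (hx : x.1 ∉ varsOf C) :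
    IsClause (insert x C) := by
  intro y hy hy'
  rw [Finset.mem_insert] at hy hy'
  rcases hy with rfl | hy
  · rcases hy' with h | h
    · exact Lit.compl_ne _ h
    · exact hx (mem_varsOf.2 ⟨_, h⟩)
  · rcases hy' with h | h
    · exact hx (by rw [← h]; exact mem_varsOf.2 ⟨y.2, hy⟩)
    · exact hC y hy h

theorem InjectiveLabels.isClause_clauseAt {T : BinaryTree V} (hT : InjectiveLabels T)
    (w : List Bool) : IsClause (clauseAt T w) := by
  induction T generalizing w with
  | nil => simp [clauseAt, IsClause]
  | node v l r ihl ihr =>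
    rcases w with _ | ⟨b, p⟩
    · simp [clauseAt, IsClause]
    · rw [clauseAt_cons]
      refine isClause_insert ?_ fun h => hT.notMem_child b (varsOf_clauseAt_subset _ _ h)
      cases b
      · exact ihr (hT.child false) p
      · exact ihl (hT.child true) p

/-- The two paths separate at an inner node, whose variable they take with opposite signs. -/
theorem exists_clash {T : BinaryTree V} {w w' : List Bool} (hw : w ∈ leaves T)
    (hw' : w' ∈ leaves T) (hne : w ≠ w') :
    ∃ x ∈ clauseAt T w, Lit.compl x ∈ clauseAt T w' := by
  induction T generalizing w w' with
  | nil =>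
    simp only [leaves, Finset.mem_singleton] at hw hw'
    exact absurd (hw.trans hw'.symm) hne
  | node v l r ihl ihr =>
    obtain ⟨b, p, rfl, hp⟩ := mem_leaves_node.1 hw
    obtain ⟨b', p', rfl, hp'⟩ := mem_leaves_node.1 hw'
    by_cases hb : b' = b
    · subst hb
      have hpp : p ≠ p' := by rintro rfl; exact hne rfl
      have : ∃ x ∈ clauseAt (child l r b') p, Lit.compl x ∈ clauseAt (child l r b') p' := by
        cases b'
        · exact ihr hp hp' hpp
        · exact ihl hp hp' hpp
      obtain ⟨x, hx, hx'⟩ := this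
      simp only [clauseAt_cons]
      exact ⟨x, Finset.mem_insert_of_mem hx, Finset.mem_insert_of_mem hx'⟩
    · refine ⟨(v, b), by simp [clauseAt_cons], ?_⟩
      have : b' = !b := Bool.eq_not.2 hb
      subst this
      simp [clauseAt_cons, Lit.compl]

theorem InjectiveLabels.clauseAt_injOn {T : BinaryTree V} (hT : InjectiveLabels T) :
    Set.InjOn (clauseAt T) (leaves T : Set (List Bool)) := by
  intro w hw w' hw' h
  by_contra hne
  obtain ⟨x, hx, hx'⟩ := exists_clash hw hw' hne
  rw [← h] at hx'
  exact hT.isClause_clauseAt w x hx hx'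

/-- Links clause membership to the positional description of the subtree below an edge. -/
theorem mem_clauseAt_iff {T : BinaryTree V} {w : List Bool} {x : Lit V} :
    x ∈ clauseAt T w ↔ ∃ p, labelAt T p = some x.1 ∧ p ++ [x.2] <+: w := by
  induction T generalizing w with
  | nil => simp [clauseAt, labelAt]
  | node v l r ihl ihr =>
    rcases w with _ | ⟨b, w⟩
    · simp [clauseAt]
    · have ih : x ∈ clauseAt (child l r b) w ↔
          ∃ p, labelAt (child l r b) p = some x.1 ∧ p ++ [x.2] <+: w := by
        cases b
        · exact ihr
        · exact ihl
      rw [clauseAt_cons, Finset.mem_insert, ih]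
      constructor
      · rintro (rfl | ⟨p, hp, hw⟩)
        · exact ⟨[], rfl, by simp⟩
        · exact ⟨b :: p, by rwa [labelAt_cons], by simpa using hw⟩
      · rintro ⟨_ | ⟨b', p⟩, hp, hw⟩
        · left
          simp only [labelAt, Option.some.injEq] at hp
          simp only [List.nil_append, List.cons_prefix_cons, List.nil_prefix, and_true] at hw
          rw [hp, ← hw]
        · rw [List.cons_append, List.cons_prefix_cons] at hw
          obtain ⟨rfl, hw⟩ := hw
          rw [labelAt_cons] at hp
          exact Or.inr ⟨p, hp, hw⟩

theorem mem_leavesBelow {T : BinaryTree V} {w : List Bool} (hw : w ∈ leaves T) {x : Lit V} :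
    w ∈ leavesBelow T x ↔ x ∈ clauseAt T w := by
  simp [leavesBelow, mem_clauseAt_iff, hw]

theorem mem_treeClauses {T : BinaryTree V} {C : LitSet V} :
    C ∈ treeClauses T ↔ ∃ w ∈ leaves T, clauseAt T w = C := by
  simp [treeClauses]

theorem treeClauses_node {v : V} {l r : BinaryTree V} :
    treeClauses (.node v l r) = (treeClauses l).image (insert (v, true)) ∪
      (treeClauses r).image (insert (v, false)) := by
  unfold treeClauses
  rw [leaves, Finset.image_union, Finset.image_image, Finset.image_image, Finset.image_image,
    Finset.image_image]
  rfl

theorem vars_treeClauses (T : BinaryTree V) : vars (treeClauses T) = nodeLabels T := by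
  refine subset_antisymm ?_ ?_
  · intro v hv
    obtain ⟨C, hC, hv⟩ := mem_vars.1 hv
    obtain ⟨w, -, rfl⟩ := mem_treeClauses.1 hC
    exact varsOf_clauseAt_subset T w hv
  · induction T with
    | nil => simp [nodeLabels]
    | node v l r ihl ihr =>
      have hsub : ∀ (b : Bool) (S : BinaryTree V), nodeLabels S ⊆ vars (treeClauses S) →
          (treeClauses S).image (insert (v, b)) ⊆ treeClauses (.node v l r) →
          insert v (nodeLabels S) ⊆ vars (treeClauses (.node v l r)) := by
        intro b S hS hSS a ha
        refine vars_mono hSS (mem_vars.2 ?_)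
        rcases Finset.mem_insert.1 ha with rfl | ha
        · obtain ⟨p, hp⟩ := leaves_nonempty S
          exact ⟨_, Finset.mem_image_of_mem _ (mem_treeClauses.2 ⟨p, hp, rfl⟩),
            by simp [varsOf_insert]⟩
        · obtain ⟨C, hC, haC⟩ := mem_vars.1 (hS ha)
          exact ⟨_, Finset.mem_image_of_mem _ hC, by simp [varsOf_insert, haC]⟩
      have h1 := hsub true l ihl (by rw [treeClauses_node]; exact Finset.subset_union_left)
      have h2 := hsub false r ihr (by rw [treeClauses_node]; exact Finset.subset_union_right)
      intro a ha
      simp only [nodeLabels, Finset.mem_insert, Finset.mem_union] at ha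
      rcases ha with rfl | ha | ha
      · exact h1 (by simp)
      · exact h1 (by simp [ha])
      · exact h2 (by simp [ha])

theorem notMem_of_treeClauses {T : BinaryTree V} {v : V} (hv : v ∉ nodeLabels T) {C : LitSet V}
    (hC : C ∈ treeClauses T) (b : Bool) : (v, b) ∉ C := by
  rw [← vars_treeClauses] at hv
  exact fun h => hv (mem_vars.2 ⟨C, hC, mem_varsOf.2 ⟨b, h⟩⟩)

theorem InjectiveLabels.isClauseSet {T : BinaryTree V} (hT : InjectiveLabels T) :
    IsClauseSet (treeClauses T) := by
  intro C hC
  obtain ⟨w, -, rfl⟩ := mem_treeClauses.1 hC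
  exact hT.isClause_clauseAt w

/-! ### Existence and uniqueness of the tree -/

/-- Once the root label is known, the clause-set determines both children; this drives the
uniqueness proof. -/
theorem InjectiveLabels.filter_treeClauses {v : V} {l r : BinaryTree V}
    (h : InjectiveLabels (.node v l r)) (b : Bool) :
    ((treeClauses (.node v l r)).filter ((v, b) ∈ ·)).image (fun C => C.erase (v, b)) =
      treeClauses (DopedCNF.child l r b) := by
  rw [treeClauses_node, Finset.filter_union]
  have key : ∀ (b' : Bool) (S : BinaryTree V), v ∉ nodeLabels S →
      ((((treeClauses S).image (insert (v, b'))).filter ((v, b) ∈ ·)).image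
        (fun C => C.erase (v, b))) = if b' = b then treeClauses S else ∅ := by
    intro b' S hS
    split_ifs with hb
    · subst hb
      rw [Finset.filter_true_of_mem, Finset.image_image]
      · refine (Finset.image_congr fun C hC => ?_).trans Finset.image_id
        exact Finset.erase_insert (notMem_of_treeClauses hS hC b')
      · intro C hC
        obtain ⟨D, -, rfl⟩ := Finset.mem_image.1 hC
        simp
    · rw [Finset.image_eq_empty, Finset.filter_eq_empty_iff]
      intro C hC
      obtain ⟨D, hD, rfl⟩ := Finset.mem_image.1 hC
      have := notMem_of_treeClauses hS hD b
      simp [this, Ne.symm hb]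
  rw [Finset.image_union, key true l (h.notMem_child true), key false r (h.notMem_child false)]
  cases b <;> simp

theorem InjectiveLabels.eq_of_treeClauses_eq {T T' : BinaryTree V} (hT : InjectiveLabels T)
    (hT' : InjectiveLabels T') (h : treeClauses T = treeClauses T') : T = T' := by
  induction T generalizing T' with
  | nil =>
    cases T' with
    | nil => rfl
    | node v l r =>
      have h1 : ∅ ∈ treeClauses (.nil : BinaryTree V) := by simp [treeClauses, leaves, clauseAt]
      rw [h, treeClauses_node] at h1
      simp at h1
  | node v l r ihl ihr =>
    cases T' with
    | nil =>
      have h1 : ∅ ∈ treeClauses (.nil : BinaryTree V) := by simp [treeClauses, leaves, clauseAt]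
      rw [← h, treeClauses_node] at h1
      simp at h1
    | node v' l' r' =>
      have hv : v = v' := by
        by_contra hne
        -- The root label `v'` of the other tree occurs in every clause. If it differed from `v`, it
        -- would label nodes in both children of the first tree.
        have key : ∀ b, v' ∈ nodeLabels (DopedCNF.child l r b) := by
          intro b
          obtain ⟨p, hp⟩ := leaves_nonempty (DopedCNF.child l r b)
          have h1 : insert (v, b) (clauseAt (DopedCNF.child l r b) p) ∈
              treeClauses (.node v' l' r') := by
            rw [← h]
            exact mem_treeClauses.2 ⟨b :: p, cons_mem_leaves_node.2 hp, clauseAt_cons⟩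
          obtain ⟨w, hw, hwC⟩ := mem_treeClauses.1 h1
          obtain ⟨b', p', rfl, -⟩ := mem_leaves_node.1 hw
          have h2 : (v', b') ∈ insert (v, b) (clauseAt (DopedCNF.child l r b) p) := by
            rw [← hwC, clauseAt_cons]
            simp
          rcases Finset.mem_insert.1 h2 with h2 | h2
          · exact absurd (congrArg Prod.fst h2).symm hne
          · exact fst_mem_nodeLabels h2
        exact hT.notMem_other (key true) (key false)
      subst hv
      have e : ∀ b, treeClauses (DopedCNF.child l r b) = treeClauses (DopedCNF.child l' r' b) := by
        intro b
        rw [← hT.filter_treeClauses, ← hT'.filter_treeClauses, h]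
      have e1 : l = l' := ihl (hT.child true) (hT'.child true) (e true)
      have e2 : r = r' := ihr (hT.child false) (hT'.child false) (e false)
      rw [e1, e2]

/-- Splitting a leaf of a labelled tree by a new variable. -/
theorem InjectiveLabels.exists_split_leaf {T : BinaryTree V} (hT : InjectiveLabels T) {v : V}
    (hv : v ∉ nodeLabels T) {C : LitSet V} (hC : C ∈ treeClauses T) :
    ∃ T' : BinaryTree V, InjectiveLabels T' ∧ nodeLabels T' = insert v (nodeLabels T) ∧
      treeClauses T' = insert (insert (v, true) C) (insert (insert (v, false) C)
        ((treeClauses T).erase C)) := by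
  induction T generalizing C with
  | nil =>
    have hC : C = ∅ := by simpa [treeClauses, leaves, clauseAt] using hC
    subst hC
    refine ⟨.node v .nil .nil, ?_, rfl, ?_⟩
    · rw [injectiveLabels_node]
      simp [nodeLabels, injectiveLabels_nil]
    · rw [treeClauses_node]
      simp [treeClauses, leaves, clauseAt]
  | node a l r ihl ihr =>
    have hva : v ≠ a := by rintro rfl; exact hv (by simp [nodeLabels])
    have hvl : v ∉ nodeLabels l := fun h => hv (by simp [nodeLabels, h])
    have hvr : v ∉ nodeLabels r := fun h => hv (by simp [nodeLabels, h])
    have key : ∀ (b : Bool) (S : BinaryTree V), a ∉ nodeLabels S → ∀ D ∈ treeClauses S,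
        (insert (insert (v, true) D) (insert (insert (v, false) D)
          ((treeClauses S).erase D))).image (insert (a, b)) =
        insert (insert (v, true) (insert (a, b) D)) (insert (insert (v, false) (insert (a, b) D))
          (((treeClauses S).image (insert (a, b))).erase (insert (a, b) D))) := by
      intro b S haS D hD
      rw [Finset.image_insert, Finset.image_insert, Finset.insert_comm (a, b),
        Finset.insert_comm (a, b)]
      congr 2
      ext E
      simp only [Finset.mem_image, Finset.mem_erase]
      constructor
      · rintro ⟨E', ⟨hne, hE'⟩, rfl⟩
        refine ⟨fun h => hne ?_, E', hE', rfl⟩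
        rw [← Finset.erase_insert (notMem_of_treeClauses haS hE' b), h,
          Finset.erase_insert (notMem_of_treeClauses haS hD b)]
      · rintro ⟨hne, E', hE', rfl⟩
        exact ⟨E', ⟨by rintro rfl; exact hne rfl, hE'⟩, rfl⟩
    -- Clauses of the two children carry `a` with opposite signs, so removing one on one side leaves
    -- the other side unchanged.
    have hother : ∀ (b b' : Bool) (D : LitSet V) (S : BinaryTree V), a ∉ nodeLabels S → b ≠ b' →
        insert (a, b) D ∉ (treeClauses S).image (insert (a, b')) := by
      intro b b' D S haS hbb h
      obtain ⟨E, hE, hEq⟩ := Finset.mem_image.1 h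
      have : (a, b) ∈ insert (a, b') E := by rw [hEq]; simp
      rcases Finset.mem_insert.1 this with h | h
      · simp [hbb] at h
      · exact notMem_of_treeClauses haS hE b h
    have hT2 := injectiveLabels_node.1 hT
    rw [treeClauses_node, Finset.mem_union, Finset.mem_image, Finset.mem_image] at hC
    rcases hC with ⟨D, hD, rfl⟩ | ⟨D, hD, rfl⟩
    · obtain ⟨S, hS, hSl, hSc⟩ := ihl hT2.2.2.2.1 hvl hD
      refine ⟨.node a S r, ?_, ?_, ?_⟩
      · rw [injectiveLabels_node, hSl, Finset.disjoint_insert_left, Finset.mem_insert, not_or]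
        exact ⟨⟨hva.symm, hT2.1⟩, hT2.2.1, ⟨hvr, hT2.2.2.1⟩, hS, hT2.2.2.2.2⟩
      · simp only [nodeLabels, hSl, Finset.insert_union]
        rw [Finset.insert_comm]
      · rw [treeClauses_node, treeClauses_node, hSc, key true l hT2.1 D hD,
          Finset.erase_union_distrib,
          Finset.erase_eq_of_notMem (hother true false D r hT2.2.1 (by simp))]
        simp only [Finset.insert_union]
    · obtain ⟨S, hS, hSl, hSc⟩ := ihr hT2.2.2.2.2 hvr hD
      refine ⟨.node a l S, ?_, ?_, ?_⟩
      · rw [injectiveLabels_node, hSl, Finset.disjoint_insert_right, Finset.mem_insert, not_or]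
        exact ⟨hT2.1, ⟨hva.symm, hT2.2.1⟩, ⟨hvl, hT2.2.2.1⟩, hT2.2.2.2.1, hS⟩
      · simp only [nodeLabels, hSl, Finset.union_insert]
        rw [Finset.insert_comm]
      · rw [treeClauses_node, treeClauses_node, hSc, key false r hT2.2.1 D hD,
          Finset.erase_union_distrib,
          Finset.erase_eq_of_notMem (hother false true D l hT2.1 (by simp))]
        simp only [Finset.union_insert]

theorem IsSaturatedMinUnsat.exists_tree {F : LitSets V} (hF : IsSaturatedMinUnsat F)
    (hcard : F.card = (vars F).card + 1) :
    ∃ T : BinaryTree V, InjectiveLabels T ∧ treeClauses T = F := by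
  induction hn : F.card using Nat.strong_induction_on generalizing F with
  | _ n ih =>
    by_cases h2 : 2 ≤ F.card
    · obtain ⟨v, C, hvC, h₁, h₂, honly⟩ := hF.exists_twins hcard h2
      obtain ⟨G, hG, hCG, hvG, hFG, hFc, hFv⟩ := hF.merge_twins hvC h₁ h₂ honly
      have hGc : (insert C G).card = G.card + 1 := Finset.card_insert_of_notMem hCG
      have hFv' : (vars F).card = (vars (insert C G)).card + 1 := by
        rw [hFv, Finset.card_insert_of_notMem hvG]
      obtain ⟨T, hT, hTG⟩ := ih (insert C G).card (by omega) hG (by omega) rfl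
      have hvT : v ∉ nodeLabels T := by rwa [← vars_treeClauses, hTG]
      obtain ⟨T', hT', -, hTc⟩ := hT.exists_split_leaf hvT (C := C) (by rw [hTG]; simp)
      refine ⟨T', hT', ?_⟩
      rw [hTc, hTG, Finset.erase_insert hCG, ← hFG]
    · have h1 : F.card = 1 := by omega
      obtain ⟨C, rfl⟩ := Finset.card_eq_one.1 h1
      have h0 : vars {C} = ∅ := by
        rw [← Finset.card_eq_zero]
        omega
      have hC : C = ∅ := by
        rw [Finset.eq_empty_iff_forall_notMem]
        intro x hx
        have : x.1 ∈ vars {C} := mem_vars.2 ⟨C, by simp, mem_varsOf_of_mem hx⟩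
        simp [h0] at this
      subst hC
      exact ⟨.nil, injectiveLabels_nil, by simp [treeClauses, leaves, clauseAt]⟩

end

/-! ### Pure clauses of sets of leaves -/

/-- The positions in the `b`-child that belong to `W`. -/
def childPositions (W : Finset (List Bool)) (b : Bool) : Finset (List Bool) :=
  (W.filter fun w => w.head? = some b).image List.tail

theorem mem_childPositions {W : Finset (List Bool)} {b : Bool} {p : List Bool} :
    p ∈ childPositions W b ↔ b :: p ∈ W := by
  unfold childPositions
  simp only [Finset.mem_image, Finset.mem_filter]
  constructor
  · rintro ⟨_ | ⟨b', q⟩, ⟨hw, hb⟩, rfl⟩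
    · simp at hb
    · simp only [List.head?_cons, Option.some.injEq] at hb
      subst hb
      exact hw
  · intro h
    exact ⟨b :: p, ⟨h, rfl⟩, rfl⟩

theorem childPositions_subset {V : Type*} {v : V} {l r : BinaryTree V} {W : Finset (List Bool)}
    (hW : W ⊆ leaves (.node v l r)) (b : Bool) : childPositions W b ⊆ leaves (child l r b) :=
  fun _ hp => cons_mem_leaves_node.1 (hW (mem_childPositions.1 hp))

section

variable {V : Type*} [DecidableEq V]

theorem isClause_pureClause (F : LitSets V) : IsClause (pureClause F) := by
  intro x hx hx'
  rw [mem_pureClause] at hx hx'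
  obtain ⟨C, hC, hxC⟩ := hx'.1
  exact hx.2 C hC hxC

theorem mem_purePart {T : BinaryTree V} {W : Finset (List Bool)} {x : Lit V} :
    x ∈ purePart T W ↔
      (∃ w ∈ W, x ∈ clauseAt T w) ∧ ∀ w ∈ W, Lit.compl x ∉ clauseAt T w := by
  simp [purePart, mem_pureClause]

theorem mem_leafSetClause {T : BinaryTree V} {u : LitSet V → V} {W : Finset (List Bool)}
    {x : Lit V} : x ∈ leafSetClause T u W ↔
      (∃ w ∈ W, x ∈ dopedClause u (clauseAt T w)) ∧
        ∀ w ∈ W, Lit.compl x ∉ dopedClause u (clauseAt T w) := by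
  simp [leafSetClause, mem_pureClause]

theorem mem_dopingPart {T : BinaryTree V} {u : LitSet V → V} {W : Finset (List Bool)}
    {x : Lit V} : x ∈ dopingPart T u W ↔ ∃ w ∈ W, (u (clauseAt T w), true) = x := by
  simp [dopingPart]

theorem mem_dopedClause {u : LitSet V → V} {C : LitSet V} {x : Lit V} :
    x ∈ dopedClause u C ↔ x = (u C, true) ∨ x ∈ C := by
  simp [dopedClause]

theorem mem_doping {u : LitSet V → V} {T : BinaryTree V} {C : LitSet V} :
    C ∈ doping u (treeClauses T) ↔ ∃ w ∈ leaves T, dopedClause u (clauseAt T w) = C := by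
  simp [doping, treeClauses]

theorem varsOf_purePart_subset (T : BinaryTree V) (W : Finset (List Bool)) :
    varsOf (purePart T W) ⊆ nodeLabels T := by
  intro v hv
  obtain ⟨b, hb⟩ := mem_varsOf.1 hv
  obtain ⟨⟨w, -, hw⟩, -⟩ := mem_purePart.1 hb
  exact fst_mem_nodeLabels hw

theorem IsDopingMap.notMem_nodeLabels {T : BinaryTree V} {u : LitSet V → V}
    (hu : IsDopingMap (treeClauses T) u) {w : List Bool} (hw : w ∈ leaves T) :
    u (clauseAt T w) ∉ nodeLabels T := by
  rw [← vars_treeClauses]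
  exact hu.2 _ (mem_treeClauses.2 ⟨w, hw, rfl⟩)

theorem IsDopingMap.eq_of_eq {T : BinaryTree V} (hT : InjectiveLabels T) {u : LitSet V → V}
    (hu : IsDopingMap (treeClauses T) u) {w w' : List Bool} (hw : w ∈ leaves T)
    (hw' : w' ∈ leaves T) (h : u (clauseAt T w) = u (clauseAt T w')) : w = w' :=
  hT.clauseAt_injOn hw hw'
    (hu.1 (mem_treeClauses.2 ⟨w, hw, rfl⟩) (mem_treeClauses.2 ⟨w', hw', rfl⟩) h)

theorem IsDopingMap.isClause_dopedClause {T : BinaryTree V} (hT : InjectiveLabels T)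
    {u : LitSet V → V} (hu : IsDopingMap (treeClauses T) u) {w : List Bool}
    (hw : w ∈ leaves T) : IsClause (dopedClause u (clauseAt T w)) :=
  isClause_insert (hT.isClause_clauseAt w)
    fun h => hu.notMem_nodeLabels hw (varsOf_clauseAt_subset T w h)

theorem IsDopingMap.isClauseSet_doping {T : BinaryTree V} (hT : InjectiveLabels T)
    {u : LitSet V → V} (hu : IsDopingMap (treeClauses T) u) :
    IsClauseSet (doping u (treeClauses T)) := by
  intro C hC
  obtain ⟨w, hw, rfl⟩ := mem_doping.1 hC
  exact hu.isClause_dopedClause hT hw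

theorem IsDopingMap.leafSetClause_eq {T : BinaryTree V} {u : LitSet V → V}
    (hu : IsDopingMap (treeClauses T) u) {W : Finset (List Bool)} (hW : W ⊆ leaves T) :
    leafSetClause T u W = dopingPart T u W ∪ purePart T W := by
  ext x
  simp only [mem_leafSetClause, Finset.mem_union, mem_dopingPart, mem_purePart, mem_dopedClause,
    not_or]
  constructor
  · rintro ⟨⟨w, hw, rfl | hx⟩, hc⟩
    · exact Or.inl ⟨w, hw, rfl⟩
    · exact Or.inr ⟨⟨w, hw, hx⟩, fun w' hw' => (hc w' hw').2⟩
  · rintro (⟨w, hw, rfl⟩ | ⟨⟨w, hw, hx⟩, hc⟩)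
    · refine ⟨⟨w, hw, Or.inl rfl⟩, fun w' hw' => ⟨by simp [Lit.compl], fun h => ?_⟩⟩
      exact hu.notMem_nodeLabels (hW hw) (fst_mem_nodeLabels h)
    · refine ⟨⟨w, hw, Or.inr hx⟩, fun w' hw' => ⟨fun h => ?_, hc w' hw'⟩⟩
      refine hu.notMem_nodeLabels (hW hw') ?_
      have h1 : x.1 = u (clauseAt T w') := congrArg Prod.fst h
      rw [← h1]
      exact fst_mem_nodeLabels hx

theorem IsDopingMap.disjoint_parts {T : BinaryTree V} {u : LitSet V → V}
    (hu : IsDopingMap (treeClauses T) u) {W : Finset (List Bool)} (hW : W ⊆ leaves T) :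
    Disjoint (dopingPart T u W) (purePart T W) := by
  rw [Finset.disjoint_left]
  intro x hx hx'
  obtain ⟨w, hw, rfl⟩ := mem_dopingPart.1 hx
  exact hu.notMem_nodeLabels (hW hw) (varsOf_purePart_subset T W (mem_varsOf_of_mem hx'))

/-- The children have disjoint variables, so purity inside a child is unaffected by the other one. A
root literal is pure exactly when all of `W` lies in its child. -/
theorem InjectiveLabels.mem_purePart_node {v : V} {l r : BinaryTree V}
    (hT : InjectiveLabels (.node v l r)) {W : Finset (List Bool)}
    (hW : W ⊆ leaves (.node v l r)) {x : Lit V} :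
    x ∈ purePart (.node v l r) W ↔
      (∃ b, x ∈ purePart (DopedCNF.child l r b) (childPositions W b)) ∨
        x.1 = v ∧ (childPositions W x.2).Nonempty ∧ childPositions W (!x.2) = ∅ := by
  have hcases : ∀ w ∈ W, ∃ b p, w = b :: p ∧ p ∈ childPositions W b := by
    intro w hw
    obtain ⟨b, p, rfl, -⟩ := mem_leaves_node.1 (hW hw)
    exact ⟨b, p, rfl, mem_childPositions.2 hw⟩
  constructor
  · intro hx
    obtain ⟨⟨w, hw, hxw⟩, hc⟩ := mem_purePart.1 hx
    obtain ⟨b, p, rfl, hp⟩ := hcases w hw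
    rw [clauseAt_cons, Finset.mem_insert] at hxw
    rcases hxw with rfl | hxp
    · refine Or.inr ⟨rfl, ⟨p, hp⟩, ?_⟩
      rw [Finset.eq_empty_iff_forall_notMem]
      intro q hq
      refine hc _ (mem_childPositions.1 hq) ?_
      rw [clauseAt_cons]
      exact Finset.mem_insert_self _ _
    · refine Or.inl ⟨b, mem_purePart.2 ⟨⟨p, hp, hxp⟩, fun q hq h => ?_⟩⟩
      refine hc _ (mem_childPositions.1 hq) ?_
      rw [clauseAt_cons]
      exact Finset.mem_insert_of_mem h
  · rintro (⟨b, hx⟩ | ⟨rfl, ⟨p, hp⟩, he⟩)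
    · obtain ⟨⟨p, hp, hxp⟩, hc⟩ := mem_purePart.1 hx
      have hxl := fst_mem_nodeLabels hxp
      refine mem_purePart.2 ⟨⟨b :: p, mem_childPositions.1 hp, ?_⟩, fun w hw h => ?_⟩
      · rw [clauseAt_cons]
        exact Finset.mem_insert_of_mem hxp
      · obtain ⟨b', q, rfl, hq⟩ := hcases w hw
        rw [clauseAt_cons, Finset.mem_insert] at h
        rcases h with h | h
        · have h1 : x.1 = v := congrArg Prod.fst h
          exact hT.notMem_child b (h1 ▸ hxl)
        · rcases Bool.eq_or_eq_not b' b with rfl | rfl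
          · exact hc q hq h
          · exact hT.notMem_other hxl (fst_mem_nodeLabels (x := Lit.compl x) h)
    · refine mem_purePart.2 ⟨⟨x.2 :: p, mem_childPositions.1 hp, ?_⟩, fun w hw h => ?_⟩
      · rw [clauseAt_cons]
        exact Finset.mem_insert_self _ _
      · obtain ⟨b', q, rfl, hq⟩ := hcases w hw
        have hb : b' = x.2 := by
          by_contra hne
          have : b' = !x.2 := Bool.eq_not.2 hne
          subst this
          simp [he] at hq
        subst hb
        rw [clauseAt_cons, Finset.mem_insert] at h
        rcases h with h | h
        · have := congrArg Prod.snd h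
          simp [Lit.compl] at this
        · exact hT.notMem_child x.2 (fst_mem_nodeLabels (x := Lit.compl x) h)

/-- Resolution along a labelled tree: from the clauses `A w ∪ C_w` for `w ∈ W` one derives the union
of the `A w` and the pure clause of the `C_w`. -/
theorem InjectiveLabels.exists_derives {T : BinaryTree V} (hT : InjectiveLabels T)
    {G : LitSets V} {W : Finset (List Bool)} (hne : W.Nonempty) (hW : W ⊆ leaves T)
    (A : List Bool → LitSet V) (hA : IsClause (W.biUnion A))
    (hAT : ∀ x ∈ W.biUnion A, x.1 ∉ nodeLabels T) (hG : ∀ w ∈ W, A w ∪ clauseAt T w ∈ G) :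
    ∃ R, Derives G R (W.biUnion A ∪ purePart T W) := by
  induction T generalizing W A with
  | nil =>
    have hW1 : W = {[]} := by
      rw [leaves, Finset.subset_singleton_iff] at hW
      exact hW.resolve_left hne.ne_empty
    subst hW1
    refine ⟨.nil, .leaf ?_⟩
    have h := hG [] (by simp)
    have hp : purePart (.nil : BinaryTree V) {[]} = ∅ := by
      rw [Finset.eq_empty_iff_forall_notMem]
      intro x hx
      simp [mem_purePart, clauseAt] at hx
    rw [hp, Finset.singleton_biUnion]
    simpa [clauseAt] using h
  | node v l r ihl ihr =>
    have hmem : ∀ {b p}, p ∈ childPositions W b → A (b :: p) ⊆ W.biUnion A := fun hp =>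
      Finset.subset_biUnion_of_mem A (mem_childPositions.1 hp)
    have hvA : ∀ x ∈ W.biUnion A, x.1 ≠ v := by
      rintro x hx rfl
      exact hAT x hx (by simp [nodeLabels])
    -- the clause derived in the child `b`
    have hchild : ∀ b, (childPositions W b).Nonempty →
        ∃ R, Derives G R (insert (v, b) ((childPositions W b).biUnion (fun p => A (b :: p)) ∪
          purePart (DopedCNF.child l r b) (childPositions W b))) := by
      intro b hb
      -- The edge literal at the root moves into the side part, so the induction hypothesis applies
      -- to the child; this is why the statement carries an arbitrary `A`.
      set A' : List Bool → LitSet V := fun p => insert (v, b) (A (b :: p)) with hA'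
      have hU : (childPositions W b).biUnion A' =
          insert (v, b) ((childPositions W b).biUnion fun p => A (b :: p)) := by
        ext x
        simp only [hA', Finset.mem_biUnion, Finset.mem_insert]
        constructor
        · rintro ⟨p, hp, rfl | hx⟩
          · exact Or.inl rfl
          · exact Or.inr ⟨p, hp, hx⟩
        · rintro (rfl | ⟨p, hp, hx⟩)
          · obtain ⟨p, hp⟩ := hb
            exact ⟨p, hp, Or.inl rfl⟩
          · exact ⟨p, hp, Or.inr hx⟩
      have hUA : ((childPositions W b).biUnion fun p => A (b :: p)) ⊆ W.biUnion A :=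
        Finset.biUnion_subset.2 fun p hp => hmem hp
      have h1 : IsClause ((childPositions W b).biUnion A') := by
        rw [hU]
        refine isClause_insert (fun x hx hx' => hA x (hUA hx) (hUA hx')) fun h => ?_
        obtain ⟨b', hb'⟩ := mem_varsOf.1 h
        exact hvA _ (hUA hb') rfl
      have h2 : ∀ x ∈ (childPositions W b).biUnion A',
          x.1 ∉ nodeLabels (DopedCNF.child l r b) := by
        rw [hU]
        intro x hx
        rcases Finset.mem_insert.1 hx with rfl | hx
        · exact hT.notMem_child b
        · exact fun h => hAT x (hUA hx) (nodeLabels_child_subset b h)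
      have h3 : ∀ p ∈ childPositions W b, A' p ∪ clauseAt (DopedCNF.child l r b) p ∈ G := by
        intro p hp
        have := hG _ (mem_childPositions.1 hp)
        rwa [clauseAt_cons, Finset.union_insert, ← Finset.insert_union] at this
      have h4 : ∃ R, Derives G R ((childPositions W b).biUnion A' ∪
          purePart (DopedCNF.child l r b) (childPositions W b)) := by
        cases b
        · exact ihr (hT.child false) hb (childPositions_subset hW false) A' h1 h2 h3
        · exact ihl (hT.child true) hb (childPositions_subset hW true) A' h1 h2 h3
      rwa [hU, Finset.insert_union] at h4
    have hbi : ∀ x, x ∈ W.biUnion A ↔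
        ∃ b, x ∈ (childPositions W b).biUnion (fun p => A (b :: p)) := by
      intro x
      simp only [Finset.mem_biUnion, mem_childPositions]
      constructor
      · rintro ⟨w, hw, hx⟩
        obtain ⟨b, p, rfl, -⟩ := mem_leaves_node.1 (hW hw)
        exact ⟨b, p, hw, hx⟩
      · rintro ⟨b, p, hp, hx⟩
        exact ⟨_, hp, hx⟩
    have hclause : IsClause (W.biUnion A ∪ purePart (.node v l r) W) := by
      intro x hx hx'
      rw [Finset.mem_union] at hx hx'
      have hl : ∀ y ∈ purePart (.node v l r) W, y.1 ∈ nodeLabels (.node v l r) := fun y hy =>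
        varsOf_purePart_subset _ _ (mem_varsOf_of_mem hy)
      rcases hx with hx | hx <;> rcases hx' with hx' | hx'
      · exact hA x hx hx'
      · exact hAT x hx (hl (Lit.compl x) hx')
      · exact hAT _ hx' (hl x hx)
      · exact isClause_pureClause _ x hx hx'
    -- If `W` meets both children, resolving on `v` removes both of its literals. Otherwise the
    -- derivation in the single child already ends in the right clause, with the root literal pure.
    by_cases hall : ∀ b, (childPositions W b).Nonempty
    · obtain ⟨R₁, h₁⟩ := hchild true (hall true)
      obtain ⟨R₂, h₂⟩ := hchild false (hall false)
      have hv : ∀ b, v ∉ varsOf ((childPositions W b).biUnion (fun p => A (b :: p)) ∪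
          purePart (DopedCNF.child l r b) (childPositions W b)) := by
        intro b h
        obtain ⟨b', hb'⟩ := mem_varsOf.1 h
        rcases Finset.mem_union.1 hb' with h | h
        · exact hvA _ ((hbi _).2 ⟨b, h⟩) rfl
        · exact hT.notMem_child b (varsOf_purePart_subset _ _ (mem_varsOf_of_mem h))
      have hE : (((childPositions W true).biUnion (fun p => A (true :: p)) ∪
          purePart (DopedCNF.child l r true) (childPositions W true)) ∪
          ((childPositions W false).biUnion (fun p => A (false :: p)) ∪
          purePart (DopedCNF.child l r false) (childPositions W false))) =
          W.biUnion A ∪ purePart (.node v l r) W := by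
        ext x
        have h1 := hbi x
        have h2 := hT.mem_purePart_node hW (x := x)
        have h3 := (hall (!x.2)).ne_empty
        rw [Bool.exists_bool] at h1 h2
        rw [or_iff_left fun h => h3 h.2.2] at h2
        rw [Finset.mem_union, Finset.mem_union, Finset.mem_union, Finset.mem_union, h1, h2,
          or_or_or_comm, or_comm (a := x ∈ (childPositions W true).biUnion _),
          or_comm (a := x ∈ purePart _ (childPositions W true))]
      exact ⟨_, hE ▸ Derives.resolve_insert h₁ h₂ (hv true) (hv false) (by rw [hE]; exact hclause)⟩
    · push Not at hall
      obtain ⟨b, hb⟩ := hall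
      have hb' : (childPositions W (!b)).Nonempty := by
        obtain ⟨w, hw⟩ := hne
        obtain ⟨b', p, rfl, -⟩ := mem_leaves_node.1 (hW hw)
        rcases Bool.eq_or_eq_not b' b with rfl | rfl
        · have : p ∈ childPositions W b' := mem_childPositions.2 hw
          simp [hb] at this
        · exact ⟨p, mem_childPositions.2 hw⟩
      obtain ⟨R, hR⟩ := hchild (!b) hb'
      refine ⟨R, ?_⟩
      have hE : insert (v, !b) ((childPositions W (!b)).biUnion (fun p => A ((!b) :: p)) ∪
          purePart (DopedCNF.child l r (!b)) (childPositions W (!b))) =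
          W.biUnion A ∪ purePart (.node v l r) W := by
        have hex : ∀ P : Bool → Prop, ¬ P b → ((∃ b', P b') ↔ P (!b)) := by
          intro P hP
          constructor
          · rintro ⟨b', h⟩
            rcases Bool.eq_or_eq_not b' b with rfl | rfl
            · exact absurd h hP
            · exact h
          · exact fun h => ⟨_, h⟩
        ext ⟨a, c⟩
        rw [Finset.mem_insert, Finset.mem_union, Finset.mem_union, hbi, hT.mem_purePart_node hW,
          hex _ (by simp [hb]), hex _ (by simp [hb, mem_purePart])]
        have : (a = v ∧ (childPositions W c).Nonempty ∧ childPositions W (!c) = ∅) ↔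
            (a, c) = (v, !b) := by
          rw [Prod.mk.injEq]
          refine and_congr_right fun _ => ?_
          rcases Bool.eq_or_eq_not c b with rfl | rfl
          · simp [hb]
          · simp [hb, hb']
        rw [this, or_comm, or_assoc]
      rwa [hE] at hR

theorem InjectiveLabels.exists_derives_leafSetClause {T : BinaryTree V} (hT : InjectiveLabels T)
    {u : LitSet V → V} (hu : IsDopingMap (treeClauses T) u) {W : Finset (List Bool)}
    (hne : W.Nonempty) (hW : W ⊆ leaves T) {G : LitSets V}
    (hG : ∀ w ∈ W, dopedClause u (clauseAt T w) ∈ G) :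
    ∃ R, Derives G R (leafSetClause T u W) := by
  have hbi : W.biUnion (fun w => ({(u (clauseAt T w), true)} : LitSet V)) = dopingPart T u W := by
    ext x
    simp [mem_dopingPart, eq_comm]
  have h := hT.exists_derives hne hW (fun w => {(u (clauseAt T w), true)}) (G := G)
  rw [hbi, ← hu.leafSetClause_eq hW] at h
  refine h ?_ ?_ hG
  · intro x hx hx'
    obtain ⟨w, hw, rfl⟩ := mem_dopingPart.1 hx
    obtain ⟨w', hw', h⟩ := mem_dopingPart.1 hx'
    simp [Lit.compl] at h
  · intro x hx
    obtain ⟨w, hw, rfl⟩ := mem_dopingPart.1 hx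
    exact hu.notMem_nodeLabels (hW hw)

/-- For `w ∈ W` there is an assignment that falsifies `C_W` and the clause of `w`, and that
satisfies the clauses of all other leaves. -/
theorem InjectiveLabels.exists_falsifying_leafSetClause {T : BinaryTree V}
    (hT : InjectiveLabels T) {u : LitSet V → V} {W : Finset (List Bool)} {w : List Bool}
    (hw : w ∈ W) (hW : W ⊆ leaves T) :
    ∃ f : V → Bool, ¬ Satisfies f (leafSetClause T u W) ∧
      ∀ w' ∈ leaves T, w' ≠ w → Satisfies f (dopedClause u (clauseAt T w')) := by
  -- Literals of `C_W` are pure over the clauses of `W`, so none of their complements occurs in the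
  -- clause of `w`.
  have hK : IsClause (clauseAt T w ∪ leafSetClause T u W) := by
    have key : ∀ x ∈ leafSetClause T u W, Lit.compl x ∉ clauseAt T w := fun x hx h =>
      (mem_leafSetClause.1 hx).2 w hw (Finset.mem_insert_of_mem h)
    intro x hx hx'
    rw [Finset.mem_union] at hx hx'
    rcases hx with hx | hx <;> rcases hx' with hx' | hx'
    · exact hT.isClause_clauseAt w x hx hx'
    · exact key _ hx' (by rwa [Lit.compl_compl])
    · exact key x hx hx'
    · exact isClause_pureClause _ x hx hx'
  obtain ⟨f, hf, -⟩ := exists_falsifying hK (fun _ => true)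
  refine ⟨f, ?_, ?_⟩
  · rintro ⟨x, hx, hfx⟩
    rw [hf x (Finset.mem_union_right _ hx)] at hfx
    simp at hfx
  · intro w' hw' hne
    obtain ⟨x, hx, hx'⟩ := exists_clash hw' (hW hw) hne
    refine ⟨x, Finset.mem_insert_of_mem hx, ?_⟩
    simpa [Lit.compl] using hf _ (Finset.mem_union_left _ hx')

theorem IsDopingMap.dopingVar_mem_iff {T : BinaryTree V} (hT : InjectiveLabels T)
    {u : LitSet V → V} (hu : IsDopingMap (treeClauses T) u) {W : Finset (List Bool)}
    (hW : W ⊆ leaves T) {w : List Bool} (hw : w ∈ leaves T) :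
    (u (clauseAt T w), true) ∈ leafSetClause T u W ↔ w ∈ W := by
  rw [hu.leafSetClause_eq hW, Finset.mem_union, mem_dopingPart]
  constructor
  · rintro (⟨w', hw', h⟩ | h)
    · rwa [← hu.eq_of_eq hT (hW hw') hw (congrArg Prod.fst h)]
    · exact absurd (varsOf_purePart_subset _ _ (mem_varsOf_of_mem h)) (hu.notMem_nodeLabels hw)
  · exact fun h => Or.inl ⟨w, h, rfl⟩

/-- Different sets of leaves give incomparable clauses. -/
theorem IsDopingMap.eq_of_leafSetClause_subset {T : BinaryTree V} (hT : InjectiveLabels T)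
    {u : LitSet V → V} (hu : IsDopingMap (treeClauses T) u) {W W' : Finset (List Bool)}
    (hW : W ⊆ leaves T) (hne : W'.Nonempty) (hW' : W' ⊆ leaves T)
    (h : leafSetClause T u W' ⊆ leafSetClause T u W) : W' = W := by
  have hsub : W' ⊆ W := fun w hw => (hu.dopingVar_mem_iff hT hW (hW' hw)).1
    (h ((hu.dopingVar_mem_iff hT hW' (hW' hw)).2 hw))
  by_contra hne'
  -- For `w` in `W` outside `W'`, an assignment falsifying `C_W` satisfies all premises of `C_W'`,
  -- so `C_W'` is not contained in `C_W`.
  obtain ⟨w, hw, hw'⟩ := Finset.exists_of_ssubset (hsub.ssubset_of_ne hne')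
  obtain ⟨f, hf, hf'⟩ := hT.exists_falsifying_leafSetClause (u := u) hw hW
  set G : LitSets V := W'.image fun w => dopedClause u (clauseAt T w) with hG
  obtain ⟨R, hR⟩ := hT.exists_derives_leafSetClause hu hne hW' (G := G)
    fun w hw => Finset.mem_image_of_mem _ hw
  have hGc : IsClauseSet G := by
    intro C hC
    obtain ⟨w', hw', rfl⟩ := Finset.mem_image.1 hC
    exact hu.isClause_dopedClause hT (hW' hw')
  refine hf ((hR.sound hGc (f := f) ?_).mono h)
  intro C hC
  obtain ⟨w', hw'', rfl⟩ := Finset.mem_image.1 hC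
  exact hf' w' (hW' hw'') (by rintro rfl; exact hw' hw'')

/-- A subset of the doped clauses is given by a set of leaves. -/
theorem exists_leafSet {T : BinaryTree V} {u : LitSet V → V} {G : LitSets V}
    (hG : G ⊆ doping u (treeClauses T)) :
    ∃ W ⊆ leaves T, G = W.image fun w => dopedClause u (clauseAt T w) := by
  refine ⟨(leaves T).filter fun w => dopedClause u (clauseAt T w) ∈ G,
    Finset.filter_subset _ _, ?_⟩
  ext C
  rw [Finset.mem_image]
  constructor
  · intro hC
    obtain ⟨w, hw, rfl⟩ := mem_doping.1 (hG hC)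
    exact ⟨w, Finset.mem_filter.2 ⟨hw, hC⟩, rfl⟩
  · rintro ⟨w, hw, rfl⟩
    exact (Finset.mem_filter.1 hw).2

/-! ### Prime implicates, total mps and the injection -/

theorem exists_leafSetClause_subset {T : BinaryTree V} {u : LitSet V → V}
    {R : BinaryTree (Lit V)} {C : LitSet V} (h : Derives (doping u (treeClauses T)) R C) :
    ∃ W : Finset (List Bool), W.Nonempty ∧ W ⊆ leaves T ∧ leafSetClause T u W ⊆ C := by
  obtain ⟨G, hG, hne, -, hp⟩ := h.exists_pureClause_subset
  obtain ⟨W, hW, rfl⟩ := exists_leafSet hG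
  exact ⟨W, Finset.image_nonempty.1 hne, hW, hp⟩

theorem IsDopingMap.primeImplicates_doping {T : BinaryTree V} (hT : InjectiveLabels T)
    {u : LitSet V → V} (hu : IsDopingMap (treeClauses T) u) :
    primeImplicates (doping u (treeClauses T)) =
      {C | ∃ W : Finset (List Bool), W.Nonempty ∧ W ⊆ leaves T ∧ C = leafSetClause T u W} := by
  have hder : ∀ W : Finset (List Bool), W.Nonempty → W ⊆ leaves T →
      ∃ R, Derives (doping u (treeClauses T)) R (leafSetClause T u W) := fun W hne hW =>
    hT.exists_derives_leafSetClause hu hne hW fun w hw => mem_doping.2 ⟨w, hW hw, rfl⟩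
  ext C
  constructor
  · rintro ⟨⟨R, hR⟩, hmin⟩
    obtain ⟨W, hne, hW, hWC⟩ := exists_leafSetClause_subset hR
    refine ⟨W, hne, hW, ?_⟩
    by_contra hCW
    exact hmin _ (hWC.ssubset_of_ne (Ne.symm hCW)) (hder W hne hW)
  · rintro ⟨W, hne, hW, rfl⟩
    refine ⟨hder W hne hW, ?_⟩
    rintro C' hC' ⟨R, hR⟩
    obtain ⟨W', hne', hW', hWC'⟩ := exists_leafSetClause_subset hR
    have := hu.eq_of_leafSetClause_subset hT hW hne' hW' (hWC'.trans hC'.subset)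
    subst this
    exact hC'.2 hWC'

theorem IsDopingMap.leafSetClause_singleton {T : BinaryTree V} (hT : InjectiveLabels T)
    {u : LitSet V → V} (hu : IsDopingMap (treeClauses T) u) {w : List Bool} (hw : w ∈ leaves T) :
    leafSetClause T u {w} = dopedClause u (clauseAt T w) := by
  ext x
  rw [mem_leafSetClause]
  simp only [Finset.mem_singleton, exists_eq_left, forall_eq]
  exact ⟨And.left, fun h => ⟨h, hu.isClause_dopedClause hT hw x h⟩⟩

/-- The doped clauses of `W` form a minimal premise set for `C_W`: they derive it, and without the
clause of some `w` the assignment falsifying `C_W` and that clause is a countermodel. -/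
theorem IsDopingMap.isTotalMps_doping {T : BinaryTree V} (hT : InjectiveLabels T)
    {u : LitSet V → V} (hu : IsDopingMap (treeClauses T) u) :
    IsTotalMps (doping u (treeClauses T)) := by
  have hcl := hu.isClauseSet_doping hT
  refine ⟨hcl, ?_, ?_⟩
  · obtain ⟨w, hw⟩ := leaves_nonempty T
    exact Finset.ne_empty_of_mem (mem_doping.2 ⟨w, hw, rfl⟩)
  ext G
  simp only [mps, Set.mem_ofPred_eq, Set.mem_sdiff, Set.mem_singleton_iff]
  refine and_congr_right fun hG => ⟨?_, fun hne => ?_⟩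
  · rintro ⟨-, C, hC, hE, -⟩ rfl
    obtain ⟨f, hf, -⟩ := exists_falsifying hC (fun _ => true)
    refine not_entails_of_models (F := ∅) (C := C) (f := f) (by simp [Models]) ?_ hE
    rintro ⟨x, hx, hfx⟩
    rw [hf x hx] at hfx
    simp at hfx
  · obtain ⟨W, hW, rfl⟩ := exists_leafSet hG
    have hWne : W.Nonempty := Finset.image_nonempty.1 (Finset.nonempty_iff_ne_empty.2 hne)
    have hGc : IsClauseSet (W.image fun w => dopedClause u (clauseAt T w)) :=
      fun C hC => hcl C (hG hC)
    refine ⟨hGc, leafSetClause T u W, isClause_pureClause _, ?_, ?_⟩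
    · obtain ⟨R, hR⟩ := hT.exists_derives_leafSetClause hu hWne hW
        (G := W.image fun w => dopedClause u (clauseAt T w))
        fun w hw => Finset.mem_image.2 ⟨w, hw, rfl⟩
      exact entails_of_models (isClause_pureClause _) fun f hf => hR.sound hGc hf
    · intro G' hG'
      obtain ⟨C, hC, hCG'⟩ := Finset.exists_of_ssubset hG'
      obtain ⟨w, hw, rfl⟩ := Finset.mem_image.1 hC
      obtain ⟨f, hf, hf'⟩ := hT.exists_falsifying_leafSetClause (u := u) hw hW
      refine not_entails_of_models (f := f) ?_ hf
      intro D hD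
      obtain ⟨w', hw', rfl⟩ := Finset.mem_image.1 (hG'.subset hD)
      exact hf' w' (hW hw') (by rintro rfl; exact hCG' hD)

theorem IsDopingMap.exists_injection {T : BinaryTree V} (hT : InjectiveLabels T)
    {u : LitSet V → V} (hu : IsDopingMap (treeClauses T) u) {F' : LitSets V}
    (hF' : IsClauseSet F') (heq : Equivalent F' (doping u (treeClauses T))) :
    ∃ i : LitSet V → LitSet V, Set.InjOn i (doping u (treeClauses T) : Set (LitSet V)) ∧
      ∀ C ∈ doping u (treeClauses T), i C ∈ F' ∧ C ⊆ i C := by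
  have hprime : primeImplicates F' = _ := heq.trans (hu.primeImplicates_doping hT)
  have key : ∀ w ∈ leaves T, ∃ E ∈ F', dopedClause u (clauseAt T w) ⊆ E ∧
      ∀ w' ∈ leaves T, (u (clauseAt T w'), true) ∈ E → w' = w := by
    intro w hw
    have h1 : dopedClause u (clauseAt T w) ∈ primeImplicates F' := by
      rw [hprime]
      exact ⟨{w}, by simp, by simpa using hw, (hu.leafSetClause_singleton hT hw).symm⟩
    obtain ⟨⟨R, hR⟩, -⟩ := h1
    obtain ⟨f, hf, hf'⟩ := exists_falsifying (hu.isClause_dopedClause hT hw) (fun _ => true)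
    have h2 : ¬ Models f F' := by
      intro h
      obtain ⟨x, hx, hfx⟩ := hR.sound hF' h
      rw [hf x hx] at hfx
      simp at hfx
    unfold Models at h2
    push Not at h2
    obtain ⟨E, hE, hfE⟩ := h2
    -- `f` is true off the doped clause of `w`, so the only doping variable that it makes false is
    -- that of `w`.
    have h3 : ∀ w' ∈ leaves T, (u (clauseAt T w'), true) ∈ E → w' = w := by
      intro w' hw' hE'
      by_contra hne
      refine hfE ⟨_, hE', hf' _ fun h => ?_⟩
      rw [dopedClause, varsOf_insert, Finset.mem_insert] at h
      rcases h with h | h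
      · exact hne (hu.eq_of_eq hT hw' hw h)
      · exact hu.notMem_nodeLabels hw' (varsOf_clauseAt_subset T w h)
    refine ⟨E, hE, ?_, h3⟩
    obtain ⟨P, hP, hPE⟩ := (Derives.leaf hE).exists_primeImplicate_subset
    rw [hprime] at hP
    obtain ⟨W, hne, hW, rfl⟩ := hP
    -- The prime implicate `C_W` inside `E` reveals `W` through its doping literals, and `E` admits
    -- only that of `w`.
    have hWw : W = {w} := Finset.eq_singleton_iff_nonempty_unique_mem.2 ⟨hne, fun w' hw' =>
      h3 w' (hW hw') (hPE ((hu.dopingVar_mem_iff hT hW (hW hw')).2 hw'))⟩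
    rwa [hWw, hu.leafSetClause_singleton hT hw] at hPE
  have key' : ∀ C : LitSet V, ∃ E, C ∈ doping u (treeClauses T) → E ∈ F' ∧ C ⊆ E ∧
      ∀ C' ∈ doping u (treeClauses T), C' ⊆ E → C' = C := by
    intro C
    by_cases hC : C ∈ doping u (treeClauses T)
    · obtain ⟨w, hw, rfl⟩ := mem_doping.1 hC
      obtain ⟨E, hE, hsub, huniq⟩ := key w hw
      refine ⟨E, fun _ => ⟨hE, hsub, fun C' hC' h => ?_⟩⟩
      obtain ⟨w', hw', rfl⟩ := mem_doping.1 hC'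
      rw [huniq w' hw' (h (Finset.mem_insert_self _ _))]
    · exact ⟨∅, fun h => absurd h hC⟩
  choose i hi using key'
  refine ⟨i, fun C hC D hD h => ?_, fun C hC => ⟨(hi C hC).1, (hi C hC).2.1⟩⟩
  have h1 := (hi C hC).2.1
  rw [h] at h1
  exact (hi D hD).2.2 C hC h1

end

/-! ### Hardness -/

/-- The Horton-Strahler number of a tree from the numbers of its two subtrees. -/
def hsNode (a b : ℕ) : ℕ := if a = b then 1 + max a b else max a b

theorem hortonStrahler_node {α : Type*} (x : α) (l r : BinaryTree α) :
    hortonStrahler (.node x l r) = hsNode (hortonStrahler l) (hortonStrahler r) := rfl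

theorem hsNode_comm (a b : ℕ) : hsNode a b = hsNode b a := by
  unfold hsNode
  split_ifs <;> omega

theorem hsNode_mono {a b c d : ℕ} (h₁ : a ≤ c) (h₂ : b ≤ d) : hsNode a b ≤ hsNode c d := by
  unfold hsNode
  split_ifs <;> omega

theorem le_hsNode_left (a b : ℕ) : a ≤ hsNode a b := by
  unfold hsNode
  split_ifs <;> omega

theorem le_hsNode_right (a b : ℕ) : b ≤ hsNode a b := by
  unfold hsNode
  split_ifs <;> omega

/-- If `a₀ ≠ a₁`, this is monotonicity. If they are equal, `a` exceeds them by at most 1, and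
raising one argument of `hsNode` by 1 raises its value by at most 1. -/
theorem hsNode_le_of_le_left {a a₀ a₁ : ℕ} (b : ℕ) (h : a ≤ hsNode a₀ a₁) :
    hsNode a b ≤ hsNode (hsNode a₀ b) (hsNode a₁ b) := by
  unfold hsNode at *
  split_ifs at * <;> omega

theorem hsNode_le_of_le_right {a a₀ a₁ : ℕ} (b : ℕ) (h : a ≤ hsNode a₀ a₁) :
    hsNode b a ≤ hsNode (hsNode b a₀) (hsNode b a₁) := by
  rw [hsNode_comm b a, hsNode_comm b a₀, hsNode_comm b a₁]
  exact hsNode_le_of_le_left b h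

section

variable {V : Type*} [DecidableEq V]

/-- The Horton-Strahler number of the tree that remains when the literals of `E` are falsified. -/
def restrictedHS (E : LitSet V) : BinaryTree V → ℕ
  | .nil => 0
  | .node v l r =>
    if (v, true) ∈ E then restrictedHS E l
    else if (v, false) ∈ E then restrictedHS E r
    else hsNode (restrictedHS E l) (restrictedHS E r)

theorem restrictedHS_empty (T : BinaryTree V) : restrictedHS ∅ T = hortonStrahler T := by
  induction T with
  | nil => rfl
  | node v l r ihl ihr => simp [restrictedHS, ihl, ihr, hortonStrahler_node]

/-- More falsified literals prune more of the tree. Since `E'` is complement-free, it cannot send a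
node already decided by `E` into the other child. -/
theorem restrictedHS_anti {E E' : LitSet V} (h : E ⊆ E') (hE' : IsClause E')
    (T : BinaryTree V) : restrictedHS E' T ≤ restrictedHS E T := by
  induction T with
  | nil => rfl
  | node v l r ihl ihr =>
    unfold restrictedHS
    by_cases h1 : (v, true) ∈ E
    · rwa [if_pos h1, if_pos (h h1)]
    · rw [if_neg h1]
      by_cases h2 : (v, false) ∈ E
      · have h3 : (v, true) ∉ E' := hE' _ (h h2)
        rwa [if_pos h2, if_neg h3, if_pos (h h2)]
      · rw [if_neg h2]
        split_ifs
        · exact ihl.trans (le_hsNode_left _ _)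
        · exact ihr.trans (le_hsNode_right _ _)
        · exact hsNode_mono ihl ihr

theorem restrictedHS_insert_of_notMem {E : LitSet V} {v : V} (b : Bool) {T : BinaryTree V}
    (hv : v ∉ nodeLabels T) : restrictedHS (insert (v, b) E) T = restrictedHS E T := by
  induction T with
  | nil => rfl
  | node a l r ihl ihr =>
    simp only [nodeLabels, Finset.mem_insert, Finset.mem_union, not_or] at hv
    have hav : a ≠ v := Ne.symm hv.1
    simp [restrictedHS, ihl hv.2.1, ihr hv.2.2, hav]

/-- Branching on one variable is no better than one node of the Horton-Strahler recursion. As labels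
are distinct, `v` occurs in at most one child, so the loss stays on one side and
`hsNode_le_of_le_left` or its mirror image passes it up. -/
theorem InjectiveLabels.restrictedHS_le {T : BinaryTree V} (hT : InjectiveLabels T)
    {E : LitSet V} {v : V} (hvE : v ∉ varsOf E) :
    restrictedHS E T ≤
      hsNode (restrictedHS (insert (v, true) E) T) (restrictedHS (insert (v, false) E) T) := by
  have hE : ∀ b, (v, b) ∉ E := fun b hb => hvE (mem_varsOf.2 ⟨b, hb⟩)
  induction T with
  | nil => exact Nat.zero_le _
  | node a l r ihl ihr =>
    obtain ⟨hal, har, hdis, hl, hr⟩ := injectiveLabels_node.1 hT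
    by_cases hav : a = v
    · subst hav
      simp [restrictedHS, hE, restrictedHS_insert_of_notMem _ hal,
        restrictedHS_insert_of_notMem _ har]
    · have hmem : ∀ b c, (a, b) ∈ insert (v, c) E ↔ (a, b) ∈ E := by simp [hav]
      simp only [restrictedHS, hmem]
      split_ifs
      · exact ihl hl
      · exact ihr hr
      · by_cases hvr : v ∈ nodeLabels r
        · have hvl : v ∉ nodeLabels l := fun h => Finset.disjoint_left.1 hdis h hvr
          simp only [restrictedHS_insert_of_notMem _ hvl]
          exact hsNode_le_of_le_right _ (ihr hr)
        · simp only [restrictedHS_insert_of_notMem _ hvr]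
          exact hsNode_le_of_le_left _ (ihl hl)

theorem restrictedHS_eq_zero {T : BinaryTree V} {E : LitSet V} (hE : IsClause E)
    {w : List Bool} (hw : w ∈ leaves T) (h : clauseAt T w ⊆ E) : restrictedHS E T = 0 := by
  induction T generalizing w with
  | nil => rfl
  | node v l r ihl ihr =>
    obtain ⟨b, p, rfl, hp⟩ := mem_leaves_node.1 hw
    rw [clauseAt_cons, Finset.insert_subset_iff] at h
    cases b
    · have h3 : (v, true) ∉ E := hE _ h.1
      rw [restrictedHS, if_neg h3, if_pos h.1]
      exact ihr hp h.2
    · rw [restrictedHS, if_pos h.1]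
      exact ihl hp h.2

/-- Resolution trees from the clauses of a labelled tree have large Horton-Strahler numbers. -/
theorem InjectiveLabels.restrictedHS_le_hortonStrahler {T : BinaryTree V}
    (hT : InjectiveLabels T) {R : BinaryTree (Lit V)} {C : LitSet V}
    (h : Derives (treeClauses T) R C) : restrictedHS C T ≤ hortonStrahler R := by
  induction h with
  | leaf hC =>
    obtain ⟨w, hw, rfl⟩ := mem_treeClauses.1 hC
    exact (restrictedHS_eq_zero (hT.isClause_clauseAt w) hw subset_rfl).le
  | @resolve R₁ R₂ C D x h₁ h₂ hx ih₁ ih₂ =>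
    have hE := (Derives.resolve h₁ h₂ hx).isClause hT.isClauseSet
    set E : LitSet V := (C ∪ D) \ {x, Lit.compl x} with hEdef
    have hxx : x ∈ C ∧ Lit.compl x ∈ D := by
      rw [← mem_complSet, ← Finset.mem_inter, hx]
      exact Finset.mem_singleton_self x
    have hxC := h₁.isClause hT.isClauseSet x hxx.1
    have hxD := h₂.isClause hT.isClauseSet _ hxx.2
    rw [Lit.compl_compl] at hxD
    -- Each parent is the resolvent plus at most its own clashing literal, so the two restrictions
    -- compared are the two branches on the variable of `x`.
    have hC : C ⊆ insert x E := by
      intro y hy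
      rw [Finset.mem_insert, hEdef, Finset.mem_sdiff, Finset.mem_insert, Finset.mem_singleton]
      by_cases hyx : y = x
      · exact Or.inl hyx
      · refine Or.inr ⟨Finset.mem_union_left _ hy, ?_⟩
        rintro (h | rfl)
        · exact hyx h
        · exact hxC hy
    have hD : D ⊆ insert (Lit.compl x) E := by
      intro y hy
      rw [Finset.mem_insert, hEdef, Finset.mem_sdiff, Finset.mem_insert, Finset.mem_singleton]
      by_cases hyx : y = Lit.compl x
      · exact Or.inl hyx
      · refine Or.inr ⟨Finset.mem_union_right _ hy, ?_⟩
        rintro (rfl | h)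
        · exact hxD hy
        · exact hyx h
    have hv : x.1 ∉ varsOf E := by
      rw [mem_varsOf]
      rintro ⟨b, hb⟩
      rw [hEdef, Finset.mem_sdiff, Finset.mem_insert, Finset.mem_singleton] at hb
      refine hb.2 ?_
      rcases Bool.eq_or_eq_not b x.2 with rfl | rfl
      · exact Or.inl rfl
      · exact Or.inr rfl
    have h1 := (restrictedHS_anti hC (isClause_insert hE hv) T).trans ih₁
    have h2 := (restrictedHS_anti hD (isClause_insert hE hv) T).trans ih₂
    rw [hortonStrahler_node]
    refine (hT.restrictedHS_le hv).trans ?_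
    obtain ⟨v, b⟩ := x
    cases b
    · rw [hsNode_comm]
      exact hsNode_mono h1 h2
    · exact hsNode_mono h1 h2

/-- Refuting along a labelled tree, where some literals are falsified by `φ`. -/
theorem InjectiveLabels.exists_derives_filter {T : BinaryTree V} (hT : InjectiveLabels T)
    (φ : PartialAssignment V) {G : LitSets V} {K : LitSet V} (hK : IsClause K)
    (hKT : ∀ x ∈ K, x.1 ∉ nodeLabels T) (hφK : ∀ x ∈ K, φ.val x.1 ≠ some x.2)
    (hG : ∀ w ∈ leaves T, (∀ x ∈ clauseAt T w, φ.val x.1 ≠ some x.2) →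
      (K ∪ clauseAt T w).filter (fun x => φ.lit x ≠ some false) ∈ G) :
    ∃ R, Derives G R (K.filter fun x => φ.lit x ≠ some false) ∧
      hortonStrahler R ≤ hortonStrahler T := by
  induction T generalizing K with
  | nil =>
    refine ⟨.nil, .leaf ?_, le_rfl⟩
    have := hG [] (by simp [leaves]) (by simp [clauseAt])
    simpa [clauseAt] using this
  | node v l r ihl ihr =>
    have hvK : v ∉ varsOf K := by
      intro h
      obtain ⟨b, hb⟩ := mem_varsOf.1 h
      exact hKT _ hb (by simp [nodeLabels])
    have hchild : ∀ b, φ.val v ≠ some b →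
        ∃ R, Derives G R ((insert (v, b) K).filter fun x => φ.lit x ≠ some false) ∧
          hortonStrahler R ≤ hortonStrahler (DopedCNF.child l r b) := by
      intro b hb
      have h1 : IsClause (insert (v, b) K) := isClause_insert hK hvK
      have h2 : ∀ x ∈ insert (v, b) K, x.1 ∉ nodeLabels (DopedCNF.child l r b) := by
        intro x hx
        rcases Finset.mem_insert.1 hx with rfl | hx
        · exact hT.notMem_child b
        · exact fun h => hKT x hx (nodeLabels_child_subset b h)
      have h3 : ∀ x ∈ insert (v, b) K, φ.val x.1 ≠ some x.2 := by
        intro x hx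
        rcases Finset.mem_insert.1 hx with rfl | hx
        · exact hb
        · exact hφK x hx
      have h4 : ∀ p ∈ leaves (DopedCNF.child l r b),
          (∀ x ∈ clauseAt (DopedCNF.child l r b) p, φ.val x.1 ≠ some x.2) →
          (insert (v, b) K ∪ clauseAt (DopedCNF.child l r b) p).filter
            (fun x => φ.lit x ≠ some false) ∈ G := by
        intro p hp hφ
        have := hG (b :: p) (cons_mem_leaves_node.2 hp) (by
          rw [clauseAt_cons]
          intro x hx
          rcases Finset.mem_insert.1 hx with rfl | hx
          · exact hb
          · exact hφ x hx)
        rwa [clauseAt_cons, Finset.union_insert, ← Finset.insert_union] at this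
      cases b
      · exact ihr (hT.child false) h1 h2 h3 h4
      · exact ihl (hT.child true) h1 h2 h3 h4
    have hle : ∀ b, hortonStrahler (DopedCNF.child l r b) ≤ hortonStrahler (.node v l r) := by
      intro b
      rw [hortonStrahler_node]
      cases b
      · exact le_hsNode_right _ _
      · exact le_hsNode_left _ _
    cases hφ : φ.val v with
    | some b =>
      -- When `φ` assigns `v`, only the child whose edge literal is false matters; that literal is
      -- filtered out, so no resolution step is needed.
      obtain ⟨R, hR, hle'⟩ := hchild (!b) (by simp [hφ])
      rw [Finset.filter_insert, if_neg
        (by rw [not_not, PartialAssignment.lit_eq_false]; simp [hφ])] at hR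
      exact ⟨R, hR, hle'.trans (hle _)⟩
    | none =>
      have hpos : ∀ b, φ.lit (v, b) ≠ some false := by
        intro b h
        rw [PartialAssignment.lit_eq_false] at h
        simp [hφ] at h
      obtain ⟨R₁, h₁, hle₁⟩ := hchild true (by simp [hφ])
      obtain ⟨R₂, h₂, hle₂⟩ := hchild false (by simp [hφ])
      rw [Finset.filter_insert, if_pos (hpos _)] at h₁ h₂
      have hv : v ∉ varsOf (K.filter fun x => φ.lit x ≠ some false) := by
        intro h
        obtain ⟨b, hb⟩ := mem_varsOf.1 h
        exact hvK (mem_varsOf.2 ⟨b, (Finset.mem_filter.1 hb).1⟩)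
      have h := Derives.resolve_insert h₁ h₂ hv hv (by
        rw [Finset.union_self]
        intro x hx hx'
        exact hK x (Finset.mem_filter.1 hx).1 (Finset.mem_filter.1 hx').1)
      rw [Finset.union_self] at h
      exact ⟨_, h, by
        rw [hortonStrahler_node, hortonStrahler_node]
        exact hsNode_mono hle₁ hle₂⟩

/-! ### The hardness of the tree clauses and of their doping -/

theorem PartialAssignment.mem_apply {φ : PartialAssignment V} {F : LitSets V} {C : LitSet V} :
    C ∈ φ.apply F ↔ ∃ D ∈ F, (∀ x ∈ D, φ.val x.1 ≠ some x.2) ∧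
      D.filter (fun x => φ.lit x ≠ some false) = C := by
  simp only [PartialAssignment.apply, Finset.mem_image, Finset.mem_filter, ne_eq,
    PartialAssignment.lit_eq_true, and_assoc]

theorem IsDopingMap.exists_refutation {T : BinaryTree V} (hT : InjectiveLabels T)
    {u : LitSet V → V} (hu : IsDopingMap (treeClauses T) u) {φ : PartialAssignment V}
    (hφ : ¬ IsSat (φ.apply (doping u (treeClauses T)))) :
    ∃ R, Derives (φ.apply (doping u (treeClauses T))) R ∅ ∧
      hortonStrahler R ≤ hortonStrahler T := by
  -- A leaf whose clause is not satisfied by `φ` must have its doping variable set to false.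
  -- Otherwise that variable could be true and the clause of `w` falsified where `φ` is undefined,
  -- which satisfies every remaining clause.
  have hval : ∀ w ∈ leaves T, (∀ x ∈ clauseAt T w, φ.val x.1 ≠ some x.2) →
      φ.val (u (clauseAt T w)) = some false := by
    intro w hw hφw
    by_contra hne
    refine hφ (isSat_iff.2 ?_)
    obtain ⟨g, hg, -⟩ := exists_falsifying (hT.isClause_clauseAt w) (fun _ => true)
    refine ⟨fun v => (φ.val v).getD (if v = u (clauseAt T w) then true else g v), ?_⟩
    intro C hC
    obtain ⟨D, hD, hφD, rfl⟩ := PartialAssignment.mem_apply.1 hC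
    obtain ⟨w', hw', rfl⟩ := mem_doping.1 hD
    by_cases hww : w' = w
    · subst hww
      refine ⟨(u (clauseAt T w'), true), Finset.mem_filter.2 ⟨Finset.mem_insert_self _ _, ?_⟩, ?_⟩
      · rw [ne_eq, PartialAssignment.lit_eq_false]
        exact hne
      · rcases h : φ.val (u (clauseAt T w')) with _ | _ | _
        · simp [h]
        · exact absurd h hne
        · simp [h]
    · obtain ⟨x, hx, hx'⟩ := exists_clash hw' hw hww
      have hφx := hφw _ hx'
      have hφx' : φ.val x.1 ≠ some x.2 := hφD x (Finset.mem_insert_of_mem hx)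
      refine ⟨x, Finset.mem_filter.2 ⟨Finset.mem_insert_of_mem hx, ?_⟩, ?_⟩
      · rw [ne_eq, PartialAssignment.lit_eq_false]
        exact hφx
      · have hnone : φ.val x.1 = none := by
          rcases h : φ.val x.1 with _ | b
          · rfl
          · rcases Bool.eq_or_eq_not b x.2 with rfl | rfl
            · exact absurd h hφx'
            · exact absurd h hφx
        have hxu : x.1 ≠ u (clauseAt T w) := fun h =>
          hu.notMem_nodeLabels hw (h ▸ fst_mem_nodeLabels hx)
        have := hg _ hx'
        simpa [hnone, hxu, Lit.compl] using this
  have h := hT.exists_derives_filter φ (G := φ.apply (doping u (treeClauses T))) (K := ∅)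
    (by simp [IsClause]) (by simp) (by simp) ?_
  · simpa using h
  · intro w hw hφw
    have hv := hval w hw hφw
    refine PartialAssignment.mem_apply.2 ⟨_, mem_doping.2 ⟨w, hw, rfl⟩, ?_, ?_⟩
    · intro x hx
      rcases mem_dopedClause.1 hx with rfl | hx
      · simp [hv]
      · exact hφw x hx
    · rw [dopedClause, Finset.filter_insert, if_neg, Finset.empty_union]
      rw [not_not, PartialAssignment.lit_eq_false]
      exact hv

/-- Setting all doping variables to false recovers the clauses of the tree. -/
theorem IsDopingMap.exists_apply_doping_eq {T : BinaryTree V}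
    {u : LitSet V → V} (hu : IsDopingMap (treeClauses T) u) :
    ∃ φ : PartialAssignment V, φ.apply (doping u (treeClauses T)) = treeClauses T := by
  refine ⟨PartialAssignment.restrict (fun _ => false) ((treeClauses T).image u), ?_⟩
  have hdop : ∀ w ∈ leaves T, (PartialAssignment.restrict (fun _ => false)
      ((treeClauses T).image u)).val (u (clauseAt T w)) = some false := fun w hw =>
    PartialAssignment.restrict_val (Finset.mem_image_of_mem _ (mem_treeClauses.2 ⟨w, hw, rfl⟩))
  have hnone : ∀ w, ∀ x ∈ clauseAt T w, (PartialAssignment.restrict (fun _ => false)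
      ((treeClauses T).image u)).val x.1 = none := by
    intro w x hx
    refine if_neg fun h => ?_
    obtain ⟨C, hC, hCx⟩ := Finset.mem_image.1 h
    obtain ⟨w', hw', rfl⟩ := mem_treeClauses.1 hC
    exact hu.notMem_nodeLabels hw' (hCx ▸ fst_mem_nodeLabels hx)
  have key : ∀ w ∈ leaves T, (dopedClause u (clauseAt T w)).filter (fun x =>
      (PartialAssignment.restrict (fun _ => false) ((treeClauses T).image u)).lit x ≠ some false) =
      clauseAt T w := by
    intro w hw
    rw [dopedClause, Finset.filter_insert, if_neg, Finset.filter_true_of_mem]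
    · intro x hx
      rw [ne_eq, PartialAssignment.lit_eq_false, hnone w x hx]
      simp
    · rw [not_not, PartialAssignment.lit_eq_false]
      exact hdop w hw
  ext C
  rw [PartialAssignment.mem_apply, mem_treeClauses]
  constructor
  · rintro ⟨D, hD, -, rfl⟩
    obtain ⟨w, hw, rfl⟩ := mem_doping.1 hD
    exact ⟨w, hw, (key w hw).symm⟩
  · rintro ⟨w, hw, rfl⟩
    refine ⟨_, mem_doping.2 ⟨w, hw, rfl⟩, ?_, key w hw⟩
    intro x hx
    rcases mem_dopedClause.1 hx with rfl | hx
    · simp [hdop w hw]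
    · simp [hnone w x hx]

theorem IsDopingMap.refutationHardness_le {T : BinaryTree V} (hT : InjectiveLabels T)
    {u : LitSet V → V} (hu : IsDopingMap (treeClauses T) u) {φ : PartialAssignment V}
    (hφ : ¬ IsSat (φ.apply (doping u (treeClauses T)))) :
    refutationHardness (φ.apply (doping u (treeClauses T))) ≤ hortonStrahler T := by
  obtain ⟨R, hR, hle⟩ := hu.exists_refutation hT hφ
  exact iInf₂_le_of_le R hR (by exact_mod_cast hle)

theorem InjectiveLabels.le_refutationHardness {T : BinaryTree V} (hT : InjectiveLabels T) :
    (hortonStrahler T : ℕ∞) ≤ refutationHardness (treeClauses T) := by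
  refine le_iInf₂ fun R hR => ?_
  rw [← restrictedHS_empty]
  exact_mod_cast hT.restrictedHS_le_hortonStrahler hR

/-- The upper bound is inherited from the doping, of which the tree clauses are the restriction with
all doping variables false. -/
theorem IsDopingMap.hardness_treeClauses {T : BinaryTree V} (hT : InjectiveLabels T)
    {u : LitSet V → V} (hu : IsDopingMap (treeClauses T) u) (hun : ¬ IsSat (treeClauses T)) :
    hardness (treeClauses T) = hortonStrahler T := by
  rw [hardness, if_pos hun]
  refine le_antisymm ?_ hT.le_refutationHardness
  obtain ⟨φ, hφ⟩ := hu.exists_apply_doping_eq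
  rw [← hφ] at hun
  have := hu.refutationHardness_le hT hun
  rwa [hφ] at this

theorem IsDopingMap.hardness_doping {T : BinaryTree V} (hT : InjectiveLabels T)
    {u : LitSet V → V} (hu : IsDopingMap (treeClauses T) u) (hun : ¬ IsSat (treeClauses T)) :
    hardness (doping u (treeClauses T)) = hortonStrahler T := by
  have hsat : IsSat (doping u (treeClauses T)) := by
    refine isSat_iff.2 ⟨fun _ => true, fun C hC => ?_⟩
    obtain ⟨w, -, rfl⟩ := mem_doping.1 hC
    exact ⟨_, Finset.mem_insert_self _ _, rfl⟩
  rw [hardness, if_neg (not_not.2 hsat), if_neg (hu.isTotalMps_doping hT).2.1]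
  refine le_antisymm (iSup₂_le fun φ hφ => hu.refutationHardness_le hT hφ) ?_
  obtain ⟨φ, hφ⟩ := hu.exists_apply_doping_eq
  refine le_iSup₂_of_le φ (by rwa [hφ]) ?_
  rw [hφ]
  exact hT.le_refutationHardness

end
end DopedCNF

theorem mainTheorem6 {V : Type*} [DecidableEq V] [Infinite V] (F : LitSets V)
    (hF : IsSaturatedMinUnsat F) (hdef : deficiency F = 1) :
    -- the labelled tree of `F` is well-defined
    (∃! T : BinaryTree V, InjectiveLabels T ∧ treeClauses T = F) ∧
    ∀ T : BinaryTree V, InjectiveLabels T → treeClauses T = F →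
    ∀ u : LitSet V → V, IsDopingMap F u →
      (∀ F' : LitSets V, IsClauseSet F' → Equivalent F' (doping u F) →
        ∃ i : LitSet V → LitSet V, Set.InjOn i (doping u F : Set (LitSet V)) ∧
          ∀ C ∈ doping u F, i C ∈ F' ∧ C ⊆ i C) ∧
      IsTotalMps (doping u F) ∧
      primeImplicates (doping u F) =
        {C | ∃ W : Finset (List Bool), W.Nonempty ∧ W ⊆ leaves T ∧ C = leafSetClause T u W} ∧
      (∀ W : Finset (List Bool), W.Nonempty → W ⊆ leaves T →
        leafSetClause T u W = dopingPart T u W ∪ purePart T W ∧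
        Disjoint (dopingPart T u W) (purePart T W) ∧
        ∀ x : Lit V, x ∈ purePart T W ↔
          (∃ w ∈ W, w ∈ leavesBelow T x) ∧ ∀ w ∈ W, w ∉ leavesBelow T (Lit.compl x)) ∧
      hardness F = (hortonStrahler T : ℕ∞) ∧
      hardness (doping u F) = (hortonStrahler T : ℕ∞) := by
  have hcard : F.card = (vars F).card + 1 := by
    unfold deficiency at hdef
    omega
  refine ⟨?_, ?_⟩
  · obtain ⟨T, hT, hTF⟩ := hF.exists_tree hcard
    exact ⟨T, ⟨hT, hTF⟩, fun T' h => h.1.eq_of_treeClauses_eq hT (h.2.trans hTF.symm)⟩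
  · rintro T hT rfl u hu
    refine ⟨fun F' hF' heq => hu.exists_injection hT hF' heq, hu.isTotalMps_doping hT,
      hu.primeImplicates_doping hT, fun W _ hW => ⟨hu.leafSetClause_eq hW, hu.disjoint_parts hW,
        fun x => ?_⟩, hu.hardness_treeClauses hT hF.1.2.1, hu.hardness_doping hT hF.1.2.1⟩
    rw [mem_purePart]
    refine and_congr (exists_congr fun w => and_congr_right fun hw => ?_)
      (forall₂_congr fun w hw => not_congr ?_)
    · exact (mem_leavesBelow (hW hw)).symm
    · exact (mem_leavesBelow (hW hw)).symm
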